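/- **Definitions.** For $a\in\mathbb C$ let $\phi_a$ be the distribution $x_+^a/\Gamma(a+1)$ on $\mathbb R$, and for $\Re a>-1$, $b\in\mathbb C$ let $\phi_{a,b}$ be the distribution $x_+^a(1-x)_+^b/(\Gamma(a+1)\Gamma(b+1))$ on $\mathbb R$ (both continued analytically from $\Re a>-1$, resp. $\Re b>-1$, where they are locally integrable functions). For distributions $S,T$ on $\mathbb R^2$ let $S\odot T$ be their pseudoconvolution (multiplicative convolution in each variable), $\langle S\odot T,F\rangle=\langle S(u,v)\otimes T(a,b),\,F(ua,vb)\rangle$. Given complex $z,z'$, put $t=zz'$ and define a distribution $N(x,-y)$ in the variables $(x,y)$ by $$N(x,-y)=t\,\bigl(\phi_{z'}(x)\phi_{-z'}(y)e^{-x-y}\bigr)\odot\bigl(\phi_{z,-z-1}(x)\phi_{-z,z-1}(y)\bigr)\odot\bigl(\delta(x-y)\chi_{[0,1]}(x)\bigr).$$ Let $W_{\kappa,\mu}$ be the Whittaker function, $$W_{\kappa,\mu}(x)=e^{-x/2}x^{\mu+1/2}\int\phi_{\mu-\kappa-1/2}(\tau)(1+\tau)^{\mu+\kappa-1/2}e^{-\tau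 x}\,d\tau ,\qquad x>0 .$$ **Proposition 2.2.** Assume $-1<\Re z<0$ and $-1<\Re z'<0$. Then the distribution $N(x,-y)$ is a locally integrable function on $\mathbb R^2$ vanishing outside the quadrant $x,y>0$ and continuous on this quadrant. For all $x,y>0$ the integral $$N_{++}(x,y)=\int_0^\infty\frac{N(x,-s)}{s+y}\,ds$$ converges absolutely, and, for any choice of the signs $\pm$, $$N_{++}(x,y)=\frac{1}{\Gamma(z)\Gamma(z')}\Bigl(\frac xy\Bigr)^{\frac{z+z'}2}e^{\frac{y-x}2}(xy)^{-\frac12}\,\frac{W_{\frac{z+z'+1}2,\pm\frac{z-z'}2}(x)\,W_{\frac{z+z'-1}2,\pm\frac{z-z'}2}(y)-W_{\frac{z+z'-1}2,\pm\frac{z-z'}2}(x)\,W_{\frac{z+z'+1}2,\pm\frac{z-z'}2}(y)}{x-y},$$ where for $x=y$ the right-hand side is understood as its limit from the points off the diagonal. -/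

import Mathlib

open Set Filter Topology MeasureTheory

noncomputable section

namespace WhittakerKernel

/-- The distribution `x_+ ^ a / Γ(a + 1)` on the line, for an arbitrary complex `a`, evaluated at a
function `f`.  For `Re a > -1` the number `k` below is `0` and this is the integral
`∫_0^∞ x ^ a / Γ(a + 1) f(x) dx`; for the other `a` it is the analytic continuation in `a`, that is
the `k`-th distributional derivative of `x_+ ^ (a + k) / Γ(a + k + 1)`, where `Re (a + k) > -1`. -/
def phi (a : ℂ) (f : ℝ → ℂ) : ℂ :=
  let k : ℕ := ⌊-a.re⌋₊
  (-1) ^ k * ∫ x in Ioi (0 : ℝ),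
    (x : ℂ) ^ (a + k) / Complex.Gamma (a + k + 1) * iteratedDeriv k f x

/-- The distribution `x_+ ^ a (1 - x)_+ ^ b / (Γ(a + 1) Γ(b + 1))` on the line, for `Re a > -1` and an
arbitrary complex `b`, evaluated at a function `f`.  For `Re b > -1` the number `m` below is `0` and
this is the integral of `f` against that function over `(0, 1)`; for the other `b` it is the analytic
continuation in `b`: the Taylor polynomial of `f` at `1` of degree `m - 1` is subtracted under the
integral, and it is paired separately through the value `(b + 1)_j / Γ(a + b + j + 2)` of the
distribution at `(1 - x) ^ j`. -/
def phiTwo (a b : ℂ) (f : ℝ → ℂ) : ℂ :=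
  let m : ℕ := ⌊-b.re⌋₊
  (∫ x in Ioo (0 : ℝ) 1,
      (x : ℂ) ^ a * ((1 - x : ℝ) : ℂ) ^ b / (Complex.Gamma (a + 1) * Complex.Gamma (b + 1)) *
        (f x - ∑ j ∈ Finset.range m,
          iteratedDeriv j f 1 / (j.factorial : ℂ) * ((x - 1 : ℝ) : ℂ) ^ j)) +
    ∑ j ∈ Finset.range m,
      iteratedDeriv j f 1 / (j.factorial : ℂ) *
        ((-1) ^ j * (ascPochhammer ℂ j).eval (b + 1) / Complex.Gamma (a + b + j + 2))

/-- The tensor product `S(x) T(y)` of two distributions on the line. -/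
def tensor (S T : (ℝ → ℂ) → ℂ) (F : ℝ × ℝ → ℂ) : ℂ :=
  S fun x => T fun y => F (x, y)

/-- The product of a distribution on the plane with a function. -/
def mulFun (T : (ℝ × ℝ → ℂ) → ℂ) (g : ℝ × ℝ → ℂ) (F : ℝ × ℝ → ℂ) : ℂ :=
  T fun p => F p * g p

/-- The distribution `δ(x - y) χ_[0,1](x)` on the plane. -/
def diagUnit (F : ℝ × ℝ → ℂ) : ℂ :=
  ∫ w in Icc (0 : ℝ) 1, F (w, w)

/-- The pseudoconvolution `S ⊙ T` of two distributions on the plane, that is the multiplicative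
convolution in each of the two variables: the image of the tensor product of `S` and `T` under
coordinatewise multiplication.  The moments of `S ⊙ T` are the products of those of `S` and `T`; for
functions on the open quadrant it is `∫∫ S(u, v) T(x / u, y / v) du dv / (u v)`. -/
def pseudoConv (S T : (ℝ × ℝ → ℂ) → ℂ) (F : ℝ × ℝ → ℂ) : ℂ :=
  S fun p => T fun q => F (p.1 * q.1, p.2 * q.2)

/-- The distribution `N(x, -y)` on the plane, in the variables `(x, y)`; it is carried by the
quadrant `x ≥ 0`, `y ≥ 0`. -/
def distN (z z' : ℂ) (F : ℝ × ℝ → ℂ) : ℂ :=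
  z * z' *
    pseudoConv
      (pseudoConv
        (mulFun (tensor (phi z') (phi (-z'))) fun p => Complex.exp (-(p.1 : ℂ) - (p.2 : ℂ)))
        (tensor (phiTwo z (-z - 1)) (phiTwo (-z) (z - 1))))
      diagUnit F

/-- The open quadrant `x > 0`, `y > 0`. -/
def quadrant : Set (ℝ × ℝ) := Ioi 0 ×ˢ Ioi 0

/-- The distribution `T` on the plane is the function which equals `n` on the open quadrant and `0`
elsewhere, and `n` is continuous on the open quadrant (which determines `n` there). The test functions
are all smooth compactly supported functions on the plane. -/
structure IsRepresentedBy (T : (ℝ × ℝ → ℂ) → ℂ) (n : ℝ × ℝ → ℂ) : Prop where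
  continuousOn : ContinuousOn n quadrant
  integrableOn : ∀ F : ℝ × ℝ → ℂ, ContDiff ℝ (⊤ : ℕ∞) F → HasCompactSupport F →
    IntegrableOn (fun p => n p * F p) quadrant
  eq_integral : ∀ F : ℝ × ℝ → ℂ, ContDiff ℝ (⊤ : ℕ∞) F → HasCompactSupport F →
    T F = ∫ p in quadrant, n p * F p

/-- The Whittaker function `W_{κ,μ}(x)`, for `x > 0` and arbitrary complex `κ`, `μ`, through its
standard integral representation
`W_{κ,μ}(x) = e ^ (-x/2) x ^ (μ + 1/2) / Γ(μ - κ + 1/2) *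
  ∫_0^∞ t ^ (μ - κ - 1/2) (1 + t) ^ (μ + κ - 1/2) e ^ (-t x) dt`,
where the integral with the factor `1 / Γ(μ - κ + 1/2)` is continued analytically if
`Re (μ - κ + 1/2) ≤ 0`. -/
def whittakerW (κ μ : ℂ) (x : ℝ) : ℂ :=
  Complex.exp (-(x : ℂ) / 2) * (x : ℂ) ^ (μ + 1 / 2) *
    phi (μ - κ - 1 / 2) fun t =>
      ((1 + t : ℝ) : ℂ) ^ (μ + κ - 1 / 2) * Complex.exp (-(t : ℂ) * (x : ℂ))

/-- The block `N_{++}(x, y) = ∫ N(x, -s) / (s + y) ds`, where `n(x, s)` stands for `N(x, -s)`. -/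
def blockPP (n : ℝ × ℝ → ℂ) (x y : ℝ) : ℂ :=
  ∫ s in Ioi (0 : ℝ), n (x, s) / ((s + y : ℝ) : ℂ)

/-- The closed expression for `N_{++}(x, y)`, `x ≠ y`, with the second indices `μ₁`, `μ₂`, `μ₃`, `μ₄`
of the four Whittaker functions. -/
def closedPP (z z' μ₁ μ₂ μ₃ μ₄ : ℂ) (x y : ℝ) : ℂ :=
  1 / (Complex.Gamma z * Complex.Gamma z') *
    ((x / y : ℝ) : ℂ) ^ ((z + z') / 2) * Complex.exp (((y : ℂ) - (x : ℂ)) / 2) *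
    ((x * y : ℝ) : ℂ) ^ (-(1 / 2) : ℂ) *
    ((whittakerW ((z + z' + 1) / 2) μ₁ x * whittakerW ((z + z' - 1) / 2) μ₂ y -
        whittakerW ((z + z' - 1) / 2) μ₃ x * whittakerW ((z + z' + 1) / 2) μ₄ y) /
      ((x - y : ℝ) : ℂ))

end WhittakerKernel

end

/-! Put `α = -z`, `β = -z'`, both with real part in `(0, 1)`. The first two factors of `N` are
tensor products, so their pseudoconvolution is a product `Φ(u) Ψ(v)` of one-variable multiplicative
convolutions, `Φ = firstDensity` and `Ψ = secondDensity`. The last factor averages a test function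
over the segment from the origin to `(u, v)`. The substitution `w = 1 / (1 + t)` moves this average
onto the densities, giving `N(x, -y) = α β ∫_0^∞ Φ(x(1+t)) Ψ(y(1+t)) dt`.

The only singular ingredient is `φ_{α,-α-1}`, which acts as `f ↦ ∫ k(b) (f(b) - f(1)) db + f(1)`
with a non-integrable singularity of `k` at `b = 1`. It still yields an integrable continuous
density `Ψ`, because the dilation difference of the smooth Gamma density is `O((1 - b) / b)`
(`norm_gammaDensity_div_sub_le`).

The Cauchy kernel `ds / (s + y)` is invariant under simultaneous dilation of `s` and `y`, so
`N_{++}` is again a ray integral, with `Ψ` replaced by its Stieltjes transform. Both factors are now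
explicit: `Φ(u)` is a constant times `u^(-β) e^(-u) U(u)` (`firstDensity_eq`), and the Stieltjes
transform of `Ψ` is `Y^α V(Y)` (`stieltjes_secondDensity`), where `U = tricomi α β` and `V = tricomi
(α + 1) (β + 1)`.

The pair `(U, V)` satisfies a first-order linear system. It makes the integrand along the ray, times
`y - x`, the `t`-derivative of a bilinear expression vanishing at infinity, so `(x - y) N_{++}` is a
boundary value (`sub_mul_rayIntegral`). Rewriting `U`, `V` as Whittaker functions gives the formula;
the free signs come from Kummer's symmetry `tricomi_symm`, and the diagonal values from continuity
of the ray integral. Since continuous representatives on the quadrant are unique, the result holds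
for every one of them. -/

namespace WhittakerKernel

/-! ### The Tricomi function and its contiguous relations. -/

/-- The integrand of the integral representation of the Tricomi function `U(α, 1 + α - β, x)`. -/
noncomputable def tricomiKernel (α β : ℂ) (x t : ℝ) : ℂ :=
  (t : ℂ) ^ (α - 1) * ((1 + t : ℝ) : ℂ) ^ (-β) * Complex.exp (-(t : ℂ) * (x : ℂ))

/-- The Tricomi function `U(α, 1 + α - β, x)`. -/
noncomputable def tricomi (α β : ℂ) (x : ℝ) : ℂ :=
  (Complex.Gamma α)⁻¹ * ∫ t in Ioi (0 : ℝ), tricomiKernel α β x t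

theorem norm_exp_neg_mul (t x : ℝ) :
    ‖Complex.exp (-(t : ℂ) * (x : ℂ))‖ = Real.exp (-(x * t)) := by
  rw [Complex.norm_exp]
  congr 1
  simp [mul_comm]

theorem measurable_ofReal_cpow (a : ℂ) : Measurable fun x : ℝ => (x : ℂ) ^ a :=
  Complex.measurable_ofReal.pow_const a

theorem measurable_tricomiKernel (α β : ℂ) (x : ℝ) : Measurable (tricomiKernel α β x) := by
  unfold tricomiKernel
  refine ((measurable_ofReal_cpow _).mul ((measurable_ofReal_cpow (-β)).comp
    (measurable_const.add measurable_id))).mul ?_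
  fun_prop

theorem norm_tricomiKernel {α β : ℂ} {x t : ℝ} (ht : 0 < t) :
    ‖tricomiKernel α β x t‖ = t ^ (α.re - 1) * (1 + t) ^ (-β.re) * Real.exp (-(x * t)) := by
  rw [tricomiKernel, norm_mul, norm_mul, norm_exp_neg_mul,
    Complex.norm_cpow_eq_rpow_re_of_pos ht, Complex.norm_cpow_eq_rpow_re_of_pos (by linarith)]
  simp

theorem norm_tricomiKernel_le {α β : ℂ} (hβ : 0 ≤ β.re) {x t : ℝ} (ht : 0 < t) :
    ‖tricomiKernel α β x t‖ ≤ t ^ (α.re - 1) * Real.exp (-(x * t)) := by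
  rw [norm_tricomiKernel ht]
  have h1 : (1 + t) ^ (-β.re) ≤ 1 :=
    Real.rpow_le_one_of_one_le_of_nonpos (by linarith) (by linarith)
  have : 0 ≤ t ^ (α.re - 1) := by positivity
  gcongr
  exact mul_le_of_le_one_right this h1

theorem integrableOn_rpow_mul_exp {a x : ℝ} (ha : 0 < a) (hx : 0 < x) :
    IntegrableOn (fun t : ℝ => t ^ (a - 1) * Real.exp (-(x * t))) (Ioi 0) := by
  have := integrableOn_rpow_mul_exp_neg_mul_rpow (p := 1) (s := a - 1) (b := x)
    (by linarith) one_pos hx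
  simpa [Real.rpow_one] using this

theorem integrableOn_tricomiKernel {α β : ℂ} (hα : 0 < α.re) (hβ : 0 ≤ β.re) {x : ℝ}
    (hx : 0 < x) : IntegrableOn (tricomiKernel α β x) (Ioi 0) :=
  (integrableOn_rpow_mul_exp hα hx).mono' (measurable_tricomiKernel α β x).aestronglyMeasurable
    (ae_restrict_of_forall_mem measurableSet_Ioi fun _ ht => norm_tricomiKernel_le hβ ht)

/-- Discarding `(1 + t)^(-β)`, of norm at most `1`, leaves a Gamma integral. The resulting decay
`x^(-Re α)` is what keeps `powerTerm` bounded away from the origin. -/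
theorem norm_tricomi_le {α β : ℂ} (hα : 0 < α.re) (hβ : 0 ≤ β.re) {x : ℝ} (hx : 0 < x) :
    ‖tricomi α β x‖ ≤ ‖(Complex.Gamma α)⁻¹‖ * ((1 / x) ^ α.re * Real.Gamma α.re) := by
  rw [tricomi, norm_mul, ← Real.integral_rpow_mul_exp_neg_mul_Ioi hα hx]
  gcongr
  exact norm_integral_le_of_norm_le (integrableOn_rpow_mul_exp hα hx)
    (ae_restrict_of_forall_mem measurableSet_Ioi fun _ ht => norm_tricomiKernel_le hβ ht)

theorem hasDerivAt_tricomi {α β : ℂ} (hα : 0 < α.re) (hβ : 0 ≤ β.re) {x : ℝ} (hx : 0 < x) :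
    HasDerivAt (tricomi α β) (-α * tricomi (α + 1) β x) x := by
  have hα0 : α ≠ 0 := by rintro rfl; simp at hα
  -- Differentiation brings down `-t`, which raises `α` by one. Restricting to parameters above `x /
  -- 2` gives a single exponential majorant.
  have key := (hasDerivAt_integral_of_dominated_loc_of_deriv_le (μ := volume.restrict (Ioi 0))
    (F := fun x t => tricomiKernel α β x t) (F' := fun x t => -tricomiKernel (α + 1) β x t)
    (x₀ := x) (s := Ioi (x / 2)) (bound := fun t => t ^ (α.re + 1 - 1) * Real.exp (-(x / 2 * t)))
    (Ioi_mem_nhds (by linarith))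
    (Eventually.of_forall fun y => (measurable_tricomiKernel α β y).aestronglyMeasurable)
    (integrableOn_tricomiKernel hα hβ hx)
    (measurable_tricomiKernel (α + 1) β x).neg.aestronglyMeasurable
    (ae_restrict_of_forall_mem measurableSet_Ioi fun t ht y hy => ?_)
    (integrableOn_rpow_mul_exp (by linarith) (by linarith))
    (ae_restrict_of_forall_mem measurableSet_Ioi fun t ht y hy => ?_)).2
  · have := key.const_mul (Complex.Gamma α)⁻¹
    refine this.congr_deriv ?_
    rw [tricomi, integral_neg, Complex.Gamma_add_one _ hα0]
    field_simp
  · have ht' : (0 : ℝ) < t := ht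
    rw [norm_neg]
    refine (norm_tricomiKernel_le hβ ht).trans ?_
    rw [Complex.add_re, Complex.one_re]
    have : x / 2 * t ≤ y * t := mul_le_mul_of_nonneg_right (le_of_lt hy) ht'.le
    gcongr
  · have ht' : (t : ℂ) ≠ 0 := by exact_mod_cast (ne_of_gt ht)
    have h1 : HasDerivAt (fun y : ℝ => -(t : ℂ) * (y : ℂ)) (-(t : ℂ)) y := by
      simpa using (HasDerivAt.ofReal_comp (hasDerivAt_id y)).const_mul (-(t : ℂ))
    refine (h1.cexp.const_mul ((t : ℂ) ^ (α - 1) * ((1 + t : ℝ) : ℂ) ^ (-β))).congr_deriv ?_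
    rw [tricomiKernel, show α + 1 - 1 = (α - 1) + 1 by ring, Complex.cpow_add _ _ ht',
      Complex.cpow_one]
    ring

/-- Integrate `(1 + t)^(-β) = (1 + t)^(-β-1) + t (1 + t)^(-β-1)`; the factor `α + 1` is `Γ(α + 2) /
Γ(α + 1)`. -/
theorem tricomi_contiguous {α β : ℂ} (hα : 0 < α.re) (hβ : 0 ≤ β.re) {x : ℝ} (hx : 0 < x) :
    tricomi (α + 1) (β + 1) x + (α + 1) * tricomi (α + 2) (β + 1) x = tricomi (α + 1) β x := by
  have hα1 : α + 1 ≠ 0 := by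
    intro h; have := congrArg Complex.re h; simp at this; linarith
  have e : ∫ t in Ioi (0 : ℝ), tricomiKernel (α + 1) β x t =
      (∫ t in Ioi (0 : ℝ), tricomiKernel (α + 1) (β + 1) x t) +
      ∫ t in Ioi (0 : ℝ), tricomiKernel (α + 2) (β + 1) x t := by
    rw [← integral_add]
    · refine setIntegral_congr_fun measurableSet_Ioi fun t (ht : 0 < t) => ?_
      have ht' : (t : ℂ) ≠ 0 := by exact_mod_cast (ne_of_gt ht)
      have ht1 : ((1 + t : ℝ) : ℂ) ≠ 0 := by exact_mod_cast (by linarith : (1 + t) ≠ 0)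
      simp only [tricomiKernel]
      rw [show -β = -(β + 1) + 1 by ring, Complex.cpow_add _ _ ht1, Complex.cpow_one,
        show α + 2 - 1 = (α + 1 - 1) + 1 by ring, Complex.cpow_add (α + 1 - 1) _ ht',
        Complex.cpow_one]
      push_cast
      ring
    · exact integrableOn_tricomiKernel (by simp; linarith) (by simp; linarith) hx
    · exact integrableOn_tricomiKernel (by simp; linarith) (by simp; linarith) hx
  have hG : Complex.Gamma (α + 2) = (α + 1) * Complex.Gamma (α + 1) := by
    rw [← Complex.Gamma_add_one _ hα1]; ring_nf
  rw [tricomi, tricomi, tricomi, e, hG]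
  field_simp

/-- The derivative of `t^α (1 + t)^(-β) e^(-tx)` has integral zero over the half-line: the boundary
term at `0` vanishes because `Re α > 0`. -/
theorem tricomi_integrate_by_parts {α β : ℂ} (hα : 0 < α.re) (hβ : 0 ≤ β.re) {x : ℝ}
    (hx : 0 < x) :
    (x : ℂ) * tricomi (α + 1) β x = tricomi α β x - β * tricomi (α + 1) (β + 1) x := by
  have hα0 : α ≠ 0 := by rintro rfl; simp at hα
  have hΓ : Complex.Gamma α ≠ 0 := Complex.Gamma_ne_zero_of_re_pos hα
  have hder : ∀ t ∈ Ioi (0 : ℝ), HasDerivAt (tricomiKernel (α + 1) β x)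
      (α * tricomiKernel α β x t - β * tricomiKernel (α + 1) (β + 1) x t
        - x * tricomiKernel (α + 1) β x t) t := by
    intro t ht
    have ht0 : (0 : ℝ) < t := ht
    have h1 : HasDerivAt (fun t : ℝ => (t : ℂ) ^ (α + 1 - 1)) (α * (t : ℂ) ^ (α - 1)) t := by
      have := (hasDerivAt_id (t : ℂ)).cpow_const (c := α) (Or.inl (by simpa using ht0))
      simpa using this.comp_ofReal
    have h2 : HasDerivAt (fun t : ℝ => ((1 + t : ℝ) : ℂ) ^ (-β))
        (-β * ((1 + t : ℝ) : ℂ) ^ (-β - 1)) t := by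
      have := ((hasDerivAt_id (t : ℂ)).const_add 1).cpow_const (c := -β)
        (Or.inl (by simp; linarith))
      simpa using this.comp_ofReal
    have h3 : HasDerivAt (fun t : ℝ => Complex.exp (-(t : ℂ) * (x : ℂ)))
        (Complex.exp (-(t : ℂ) * (x : ℂ)) * (-1 * x)) t := by
      have := (((hasDerivAt_id (t : ℂ)).neg).mul_const (x : ℂ)).cexp
      simpa using this.comp_ofReal
    refine ((h1.mul h2).mul h3).congr_deriv ?_
    simp only [tricomiKernel]
    rw [show -β - 1 = -(β + 1) by ring]
    simp only [Pi.mul_apply]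
    ring
  have i1 := integrableOn_tricomiKernel (β := β) hα hβ hx
  have i2 := integrableOn_tricomiKernel (α := α + 1) (β := β + 1)
    (by simp; linarith) (by simp; linarith) hx
  have i3 := integrableOn_tricomiKernel (α := α + 1) (β := β) (by simp; linarith) hβ hx
  have hlim : Tendsto (tricomiKernel (α + 1) β x) atTop (𝓝 0) := by
    have := tendsto_rpow_mul_exp_neg_mul_atTop_nhds_zero α.re x hx
    refine squeeze_zero_norm' ?_ this
    filter_upwards [eventually_gt_atTop 0] with t ht
    refine (norm_tricomiKernel_le hβ ht).trans_eq ?_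
    simp
  have hcont : ContinuousWithinAt (tricomiKernel (α + 1) β x) (Ici 0) 0 := by
    unfold tricomiKernel
    refine ContinuousAt.continuousWithinAt (ContinuousAt.mul (ContinuousAt.mul ?_ ?_) ?_)
    · exact Complex.continuousAt_ofReal_cpow_const (0 : ℝ) (α + 1 - 1)
        (Or.inl (by simpa using hα))
    · have h1 : ContinuousAt (fun y : ℝ => (y : ℂ) ^ (-β)) (1 + 0) :=
        Complex.continuousAt_ofReal_cpow_const (1 + 0 : ℝ) (-β) (Or.inr (by simp))
      exact ContinuousAt.comp (f := fun t : ℝ => 1 + t) h1 (by fun_prop)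
    · fun_prop
  have := integral_Ioi_of_hasDerivAt_of_tendsto hcont hder
    (((i1.const_mul α).sub (i2.const_mul β)).sub (i3.const_mul (x : ℂ))) hlim
  have h0 : tricomiKernel (α + 1) β x 0 = 0 := by
    simp [tricomiKernel, Complex.zero_cpow hα0]
  have j : IntegrableOn (fun t => α * tricomiKernel α β x t
      - β * tricomiKernel (α + 1) (β + 1) x t) (Ioi 0) := (i1.const_mul α).sub (i2.const_mul β)
  rw [h0, sub_zero, integral_sub j (i3.const_mul (x : ℂ)),
    integral_sub (i1.const_mul α) (i2.const_mul β), integral_const_mul, integral_const_mul,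
    integral_const_mul] at this
  simp only [tricomi, Complex.Gamma_add_one _ hα0]
  field_simp
  linear_combination -this

/-! ### The substitution `b = 1 / (1 + t)`, beta integrals and Kummer's symmetry. -/

theorem image_inv_one_add : (fun t : ℝ => (1 + t)⁻¹) '' Ioi 0 = Ioo 0 1 := by
  ext b
  constructor
  · rintro ⟨t, ht, rfl⟩
    have ht' : (0 : ℝ) < t := ht
    exact ⟨by positivity, inv_lt_one_of_one_lt₀ (by linarith)⟩
  · rintro ⟨h0, h1⟩
    refine ⟨b⁻¹ - 1, ?_, by simp⟩
    have := (one_lt_inv₀ h0).2 h1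
    exact sub_pos.2 this

theorem hasDerivWithinAt_inv_one_add {t : ℝ} (ht : t ∈ Ioi (0 : ℝ)) :
    HasDerivWithinAt (fun t : ℝ => (1 + t)⁻¹) (-((1 + t) ^ 2)⁻¹) (Ioi 0) t := by
  have ht' : (0 : ℝ) < t := ht
  have := ((hasDerivAt_id t).const_add 1).inv (by simp; linarith)
  refine (this.congr_deriv ?_).hasDerivWithinAt
  simp [div_eq_mul_inv]

theorem injOn_inv_one_add : InjOn (fun t : ℝ => (1 + t)⁻¹) (Ioi 0) := by
  intro a _ b _ h
  have := inv_injective h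
  linarith

theorem abs_neg_inv_sq (t : ℝ) : |-((1 + t) ^ 2)⁻¹| = ((1 + t) ^ 2)⁻¹ := by
  rw [abs_neg, abs_of_nonneg (by positivity)]

/-- The substitution `b = 1 / (1 + t)`. -/
theorem integral_Ioo_eq_integral_Ioi (f : ℝ → ℂ) :
    ∫ b in Ioo (0 : ℝ) 1, f b = ∫ t in Ioi (0 : ℝ), (((1 + t) ^ 2)⁻¹ : ℝ) • f (1 + t)⁻¹ := by
  rw [← image_inv_one_add, integral_image_eq_integral_abs_deriv_smul measurableSet_Ioi
    (fun _ => hasDerivWithinAt_inv_one_add) injOn_inv_one_add]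
  simp only [abs_neg_inv_sq]

theorem integrableOn_Ioo_iff (f : ℝ → ℂ) :
    IntegrableOn f (Ioo (0 : ℝ) 1) ↔
      IntegrableOn (fun t : ℝ => (((1 + t) ^ 2)⁻¹ : ℝ) • f (1 + t)⁻¹) (Ioi 0) := by
  rw [← image_inv_one_add, integrableOn_image_iff_integrableOn_abs_deriv_smul measurableSet_Ioi
    (fun _ => hasDerivWithinAt_inv_one_add) injOn_inv_one_add]
  simp only [abs_neg_inv_sq]

theorem inv_one_add_cpow {t : ℝ} (ht : 0 < t) (a : ℂ) :
    (((1 + t)⁻¹ : ℝ) : ℂ) ^ a = ((1 + t : ℝ) : ℂ) ^ (-a) := by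
  rw [Complex.ofReal_inv, Complex.inv_cpow, Complex.cpow_neg]
  rw [Complex.arg_ofReal_of_nonneg (by linarith)]
  exact Real.pi_pos.ne

theorem one_sub_inv_one_add_cpow {t : ℝ} (ht : 0 < t) (a : ℂ) :
    ((1 - (1 + t)⁻¹ : ℝ) : ℂ) ^ a = (t : ℂ) ^ a * ((1 + t : ℝ) : ℂ) ^ (-a) := by
  have : (1 - (1 + t)⁻¹ : ℝ) = t * (1 + t)⁻¹ := by field_simp; ring
  rw [this, Complex.ofReal_mul, Complex.mul_cpow_ofReal_nonneg ht.le (by positivity),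
    inv_one_add_cpow ht]

theorem ofReal_mul_cpow {a b : ℝ} (ha : 0 < a) (hb : 0 < b) (r : ℂ) :
    ((a * b : ℝ) : ℂ) ^ r = (a : ℂ) ^ r * (b : ℂ) ^ r := by
  rw [Complex.ofReal_mul, Complex.mul_cpow_ofReal_nonneg ha.le hb.le]

theorem inv_sq_eq_cpow {t : ℝ} : ((((1 + t) ^ 2)⁻¹ : ℝ) : ℂ) = ((1 + t : ℝ) : ℂ) ^ (-2 : ℂ) := by
  rw [Complex.cpow_neg]
  norm_cast

theorem integrableOn_Ioo_cpow {p q : ℂ} (hp : 0 < p.re) (hq : 0 < q.re) :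
    IntegrableOn (fun b : ℝ => (b : ℂ) ^ (p - 1) * ((1 - b : ℝ) : ℂ) ^ (q - 1)) (Ioo 0 1) := by
  have := Complex.betaIntegral_convergent hp hq
  rw [intervalIntegrable_iff_integrableOn_Ioo_of_le zero_le_one] at this
  simpa using this

theorem Gamma_reflection_mul (p : ℂ) (hp0 : 0 < p.re) (hp1 : p.re < 1) :
    ∫ b in Ioo (0 : ℝ) 1, (b : ℂ) ^ (-p) * ((1 - b : ℝ) : ℂ) ^ (p - 1) =
      Complex.Gamma p * Complex.Gamma (1 - p) := by
  rw [mul_comm (Complex.Gamma p), Complex.Gamma_mul_Gamma_eq_betaIntegral (by simp; linarith) hp0,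
    Complex.betaIntegral, intervalIntegral.integral_of_le zero_le_one, integral_Ioc_eq_integral_Ioo]
  simp

/-- The Mellin transform of `1 / (1 + t)`. -/
theorem mellin_inv_one_add {p : ℂ} (hp0 : 0 < p.re) (hp1 : p.re < 1) :
    IntegrableOn (fun t : ℝ => (t : ℂ) ^ (p - 1) / ((1 + t : ℝ) : ℂ)) (Ioi 0) ∧
    ∫ t in Ioi (0 : ℝ), (t : ℂ) ^ (p - 1) / ((1 + t : ℝ) : ℂ) =
      Complex.Gamma p * Complex.Gamma (1 - p) := by
  have e : ∀ t ∈ Ioi (0 : ℝ), (((1 + t) ^ 2)⁻¹ : ℝ) • ((((1 + t)⁻¹ : ℝ) : ℂ) ^ (-p) *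
      ((1 - (1 + t)⁻¹ : ℝ) : ℂ) ^ (p - 1)) = (t : ℂ) ^ (p - 1) / ((1 + t : ℝ) : ℂ) := by
    intro t ht
    have ht0 : (0 : ℝ) < t := ht
    have ht1 : ((1 + t : ℝ) : ℂ) ≠ 0 := by exact_mod_cast (by linarith : (1 + t) ≠ 0)
    rw [Complex.real_smul, inv_sq_eq_cpow, inv_one_add_cpow ht0, one_sub_inv_one_add_cpow ht0,
      div_eq_mul_inv, ← Complex.cpow_neg_one]
    rw [show (-1 : ℂ) = -2 + -(-p) + -(p - 1) by ring, Complex.cpow_add _ _ ht1,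
      Complex.cpow_add _ _ ht1]
    ring
  constructor
  · have := integrableOn_Ioo_cpow (p := 1 - p) (q := p) (by simp; linarith) hp0
    rw [show 1 - p - 1 = -p by ring, integrableOn_Ioo_iff] at this
    exact this.congr_fun e measurableSet_Ioi
  · rw [← Gamma_reflection_mul p hp0 hp1, integral_Ioo_eq_integral_Ioi]
    exact (setIntegral_congr_fun measurableSet_Ioi e).symm

theorem integral_Ioi_comp_mul (f : ℝ → ℂ) {c : ℝ} (hc : 0 < c) :
    ∫ x in Ioi (0 : ℝ), f x = c * ∫ x in Ioi (0 : ℝ), f (c * x) := by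
  rw [integral_comp_mul_left_Ioi f 0 hc, mul_zero, Complex.real_smul, ← mul_assoc]
  have : (c : ℂ) ≠ 0 := by exact_mod_cast hc.ne'
  rw [Complex.ofReal_inv, mul_inv_cancel₀ this, one_mul]

theorem mellin_inv_add {p : ℂ} (hp0 : 0 < p.re) (hp1 : p.re < 1) {c : ℝ} (hc : 0 < c) :
    IntegrableOn (fun t : ℝ => (t : ℂ) ^ (p - 1) / ((c + t : ℝ) : ℂ)) (Ioi 0) ∧
    ∫ t in Ioi (0 : ℝ), (t : ℂ) ^ (p - 1) / ((c + t : ℝ) : ℂ) =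
      (c : ℂ) ^ (p - 1) * (Complex.Gamma p * Complex.Gamma (1 - p)) := by
  have hc0 : (c : ℂ) ≠ 0 := by exact_mod_cast hc.ne'
  have e : ∀ t ∈ Ioi (0 : ℝ), (c : ℂ) ^ (p - 1) * (c : ℂ)⁻¹ *
      ((t : ℂ) ^ (p - 1) / ((1 + t : ℝ) : ℂ)) =
      ((c * t : ℝ) : ℂ) ^ (p - 1) / ((c + c * t : ℝ) : ℂ) := by
    intro t ht
    have ht0 : (0 : ℝ) < t := ht
    have ht1 : ((1 + t : ℝ) : ℂ) ≠ 0 := by exact_mod_cast (by linarith : (1 + t) ≠ 0)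
    rw [ofReal_mul_cpow hc ht0, show c + c * t = c * (1 + t) by ring, Complex.ofReal_mul c (1 + t)]
    field_simp
  obtain ⟨h1, h2⟩ := mellin_inv_one_add hp0 hp1
  constructor
  · have := IntegrableOn.congr_fun (h1.const_mul ((c : ℂ) ^ (p - 1) * (c : ℂ)⁻¹)) e
      measurableSet_Ioi
    have h3 := (integrableOn_Ioi_comp_mul_left_iff
      (fun t : ℝ => (t : ℂ) ^ (p - 1) / ((c + t : ℝ) : ℂ)) 0 hc).1 this
    simpa using h3
  · rw [integral_Ioi_comp_mul _ hc, ← setIntegral_congr_fun measurableSet_Ioi e,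
      integral_const_mul, h2]
    field_simp

/-- Kummer's transformation. Write `Γ(β) (1 + t)^(-β) = ∫ r^(β-1) e^(-(1+t)r) dr`, integrate over
`t` first to get `Γ(α) (x + r)^(-α)`, and rescale `r = x s`. This is the source of the free sign of
the second Whittaker index. -/
theorem tricomi_symm {α β : ℂ} (hα : 0 < α.re) (hβ : 0 < β.re) {x : ℝ} (hx : 0 < x) :
    tricomi α β x = (x : ℂ) ^ (β - α) * tricomi β α x := by
  have hΓα : Complex.Gamma α ≠ 0 := Complex.Gamma_ne_zero_of_re_pos hα
  have hΓβ : Complex.Gamma β ≠ 0 := Complex.Gamma_ne_zero_of_re_pos hβ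
  have hx0 : (x : ℂ) ≠ 0 := by exact_mod_cast hx.ne'
  set G : ℝ → ℝ → ℂ := fun t r => ((t : ℂ) ^ (α - 1) * Complex.exp (-(t : ℂ) * (x : ℂ))) *
    ((r : ℂ) ^ (β - 1) * Complex.exp (-((1 + t : ℝ) * r : ℂ))) with hG
  have hint : Integrable (Function.uncurry G)
      ((volume.restrict (Ioi 0)).prod (volume.restrict (Ioi 0))) := by
    have := Integrable.mul_prod (integrableOn_rpow_mul_exp hα hx)
      (integrableOn_rpow_mul_exp hβ one_pos)
    refine this.mono' ?_ ?_
    · refine Measurable.aestronglyMeasurable ?_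
      refine (((measurable_ofReal_cpow _).comp measurable_fst).mul ?_).mul
        (((measurable_ofReal_cpow _).comp measurable_snd).mul ?_)
      · fun_prop
      · fun_prop
    · rw [Measure.prod_restrict]
      refine ae_restrict_of_forall_mem (measurableSet_Ioi.prod measurableSet_Ioi) ?_
      rintro ⟨t, r⟩ ⟨ht, hr⟩
      have ht0 : (0 : ℝ) < t := ht
      have hr0 : (0 : ℝ) < r := hr
      simp only [Function.uncurry, hG]
      have hexp : ‖Complex.exp (-((1 + t : ℝ) * r : ℂ))‖ = Real.exp (-((1 + t) * r)) := by
        rw [← Complex.ofReal_mul, ← Complex.ofReal_neg, ← Complex.ofReal_exp, Complex.norm_real,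
          Real.norm_eq_abs, Real.abs_exp]
      rw [norm_mul, norm_mul, norm_mul, norm_exp_neg_mul, Complex.norm_cpow_eq_rpow_re_of_pos ht0,
        Complex.norm_cpow_eq_rpow_re_of_pos hr0, hexp]
      simp only [Complex.sub_re, Complex.one_re]
      gcongr
      nlinarith
  have swap := integral_integral_swap hint
  have L : ∀ t ∈ Ioi (0 : ℝ), ∫ r in Ioi (0 : ℝ), G t r = Complex.Gamma β *
      tricomiKernel α β x t := by
    intro t ht
    have ht0 : (0 : ℝ) < t := ht
    simp only [hG]
    rw [integral_const_mul, Complex.integral_cpow_mul_exp_neg_mul_Ioi hβ (by linarith),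
      tricomiKernel, one_div, ← Complex.ofReal_inv, inv_one_add_cpow ht0]
    ring
  have R : ∀ r ∈ Ioi (0 : ℝ), ∫ t in Ioi (0 : ℝ), G t r = Complex.Gamma α *
      ((r : ℂ) ^ (β - 1) * Complex.exp (-(r : ℂ)) * ((x + r : ℝ) : ℂ) ^ (-α)) := by
    intro r hr
    have hr0 : (0 : ℝ) < r := hr
    have hxr : 0 < x + r := by linarith
    have e : ∀ t : ℝ, G t r = ((r : ℂ) ^ (β - 1) * Complex.exp (-(r : ℂ))) *
        ((t : ℂ) ^ (α - 1) * Complex.exp (-((x + r : ℝ) * t : ℂ))) := by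
      intro t
      have : Complex.exp (-(t : ℂ) * x) * Complex.exp (-((1 + t : ℝ) * r : ℂ)) =
        Complex.exp (-(r : ℂ)) * Complex.exp (-((x + r : ℝ) * t : ℂ)) := by
        rw [← Complex.exp_add, ← Complex.exp_add]; push_cast; ring_nf
      simp only [hG]
      linear_combination (t : ℂ) ^ (α - 1) * (r : ℂ) ^ (β - 1) * this
    simp only [e]
    rw [integral_const_mul, Complex.integral_cpow_mul_exp_neg_mul_Ioi hα hxr, one_div,
      Complex.inv_cpow, ← Complex.cpow_neg]
    · ring
    · rw [Complex.arg_ofReal_of_nonneg hxr.le]; exact Real.pi_pos.ne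
  rw [setIntegral_congr_fun measurableSet_Ioi L, setIntegral_congr_fun measurableSet_Ioi R,
    integral_const_mul, integral_const_mul, integral_Ioi_comp_mul (fun r : ℝ => (r : ℂ) ^ (β - 1) *
      Complex.exp (-(r : ℂ)) * ((x + r : ℝ) : ℂ) ^ (-α)) hx] at swap
  have e : ∀ s ∈ Ioi (0 : ℝ), ((x * s : ℝ) : ℂ) ^ (β - 1) * Complex.exp (-((x * s : ℝ) : ℂ)) *
      ((x + x * s : ℝ) : ℂ) ^ (-α) = (x : ℂ) ^ (β - 1 + -α) * tricomiKernel β α x s := by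
    intro s hs
    have hs0 : (0 : ℝ) < s := hs
    rw [ofReal_mul_cpow hx hs0, show x + x * s = x * (1 + s) by ring,
      ofReal_mul_cpow hx (by linarith), Complex.cpow_add _ _ hx0, tricomiKernel]
    push_cast
    ring_nf
  rw [setIntegral_congr_fun measurableSet_Ioi e, integral_const_mul] at swap
  have hp : (x : ℂ) ^ (β - α) = x * (x : ℂ) ^ (β - 1 + -α) := by
    rw [show β - α = 1 + (β - 1 + -α) by ring, Complex.cpow_add _ _ hx0, Complex.cpow_one]
  rw [tricomi, tricomi, hp]
  field_simp
  linear_combination swap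

/-! ### Multiplicative convolution, ordinary and regularized. -/

/-- Lebesgue measure on the open half-line. -/
noncomputable abbrev halfLine : Measure ℝ := volume.restrict (Ioi 0)

/-- Lebesgue measure on the open unit interval. -/
noncomputable abbrev unitInterval : Measure ℝ := volume.restrict (Ioo 0 1)

/-- The multiplicative convolution of a density on the half-line with one on `(0, 1)`. -/
noncomputable def mulConv (h k : ℝ → ℂ) (u : ℝ) : ℂ :=
  ∫ a in Ioo (0 : ℝ) 1, k a * (h (u / a) / a)

/-- The multiplicative convolution of a density on the half-line with the distribution
`f ↦ ∫ k(b) (f(b) - f(1)) db + f(1)` on `[0, 1]`. -/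
noncomputable def regConv (h k : ℝ → ℂ) (v : ℝ) : ℂ :=
  (∫ b in Ioo (0 : ℝ) 1, k b * (h (v / b) / b - h v)) + h v

theorem ae_prod_restrict {s t : Set ℝ} (hs : MeasurableSet s) (ht : MeasurableSet t)
    {P : ℝ × ℝ → Prop} (h : ∀ x ∈ s, ∀ y ∈ t, P (x, y)) :
    ∀ᵐ p ∂((volume.restrict s).prod (volume.restrict t)), P p := by
  rw [Measure.prod_restrict]
  exact ae_restrict_of_forall_mem (hs.prod ht) fun p hp => h p.1 hp.1 p.2 hp.2

theorem integrableOn_comp_div {h : ℝ → ℂ} (hh : IntegrableOn h (Ioi 0)) {a : ℝ} (ha : 0 < a) :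
    IntegrableOn (fun u => h (u / a)) (Ioi 0) := by
  have := (integrableOn_Ioi_comp_mul_left_iff h 0 (inv_pos.2 ha)).2 (by simpa using hh)
  simpa [div_eq_inv_mul] using this

theorem integral_comp_mul_right_eq {h g : ℝ → ℂ} {a : ℝ} (ha : 0 < a) :
    ∫ x in Ioi (0 : ℝ), h x * g (x * a) = ∫ u in Ioi (0 : ℝ), h (u / a) / a * g u := by
  have ha0 : (a : ℂ) ≠ 0 := by exact_mod_cast ha.ne'
  rw [integral_Ioi_comp_mul (fun u => h (u / a) / a * g u) ha, ← integral_const_mul]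
  refine setIntegral_congr_fun measurableSet_Ioi fun x _ => ?_
  rw [mul_div_cancel_left₀ _ ha.ne', mul_comm a x]
  field_simp

theorem integrable_mulConv_kernel {h k : ℝ → ℂ} (hm : Measurable h) (km : Measurable k)
    (hh : IntegrableOn h (Ioi 0)) (hk : IntegrableOn k (Ioo 0 1)) :
    Integrable (fun p : ℝ × ℝ => k p.1 * (h (p.2 / p.1) / p.1)) (unitInterval.prod halfLine) := by
  have m : Measurable fun p : ℝ × ℝ => k p.1 * (h (p.2 / p.1) / p.1) := by fun_prop
  rw [integrable_prod_iff m.aestronglyMeasurable]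
  refine ⟨ae_restrict_of_forall_mem measurableSet_Ioo fun a ha =>
    ((integrableOn_comp_div hh ha.1).div_const (a : ℂ)).const_mul (k a), ?_⟩
  refine Integrable.congr (f := fun a => ‖k a‖ * ∫ x in Ioi (0 : ℝ), ‖h x‖) (hk.norm.mul_const _) ?_
  refine ae_restrict_of_forall_mem measurableSet_Ioo fun a ha => ?_
  have ha0 : 0 < a := ha.1
  have := integral_comp_mul_left_Ioi (fun x => ‖h x‖) 0 (inv_pos.2 ha0)
  simp only [norm_mul, norm_div, Complex.norm_real, Real.norm_eq_abs, abs_of_pos ha0]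
  rw [integral_const_mul, integral_div]
  simp only [inv_inv, mul_zero, smul_eq_mul, ← div_eq_inv_mul] at this
  rw [this]
  field_simp

theorem integrableOn_mulConv {h k : ℝ → ℂ} (hm : Measurable h) (km : Measurable k)
    (hh : IntegrableOn h (Ioi 0)) (hk : IntegrableOn k (Ioo 0 1)) :
    IntegrableOn (mulConv h k) (Ioi 0) :=
  (integrable_mulConv_kernel hm km hh hk).integral_prod_right

theorem integral_mulConv {h k G : ℝ → ℂ} (hm : Measurable h) (km : Measurable k)
    (Gm : Measurable G) (hh : IntegrableOn h (Ioi 0)) (hk : IntegrableOn k (Ioo 0 1)) {C : ℝ}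
    (hC : ∀ u, 0 < u → ‖G u‖ ≤ C) :
    ∫ x in Ioi (0 : ℝ), h x * ∫ a in Ioo (0 : ℝ) 1, k a * G (x * a) =
      ∫ u in Ioi (0 : ℝ), mulConv h k u * G u := by
  have i1 : Integrable (Function.uncurry fun x a : ℝ => h x * (k a * G (x * a)))
      (halfLine.prod unitInterval) := by
    refine ((hh.norm.mul_prod hk.norm).mul_const C).mono' ?_ ?_
    · refine Measurable.aestronglyMeasurable ?_
      unfold Function.uncurry
      fun_prop
    · refine ae_prod_restrict measurableSet_Ioi measurableSet_Ioo fun x hx a ha => ?_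
      simp only [Function.uncurry, norm_mul, mul_assoc]
      have := hC (x * a) (mul_pos hx ha.1)
      gcongr
  have i2 : Integrable (Function.uncurry fun a u : ℝ => k a * (h (u / a) / a) * G u)
      (unitInterval.prod halfLine) := by
    refine ((integrable_mulConv_kernel hm km hh hk).norm.mul_const C).mono' ?_ ?_
    · refine Measurable.aestronglyMeasurable ?_
      unfold Function.uncurry
      fun_prop
    · refine ae_prod_restrict measurableSet_Ioo measurableSet_Ioi fun a ha u hu => ?_
      simp only [Function.uncurry]
      rw [norm_mul]
      gcongr
      exact hC u hu
  simp only [← integral_const_mul, mulConv, ← integral_mul_const]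
  rw [integral_integral_swap i1, ← integral_integral_swap i2]
  refine setIntegral_congr_fun measurableSet_Ioo fun a ha => ?_
  simp only [mul_left_comm _ (k a), mul_assoc (k a)]
  rw [integral_const_mul, integral_const_mul, integral_comp_mul_right_eq ha.1]

theorem integrable_regConv_kernel {h k : ℝ → ℂ} (hm : Measurable h) (km : Measurable k)
    {M D : ℝ → ℝ} (hM : IntegrableOn M (Ioo 0 1)) (hD : IntegrableOn D (Ioi 0))
    (hMD : ∀ b ∈ Ioo (0 : ℝ) 1, ∀ v ∈ Ioi (0 : ℝ), ‖k b * (h (v / b) / b - h v)‖ ≤ M b * D v) :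
    Integrable (fun p : ℝ × ℝ => k p.1 * (h (p.2 / p.1) / p.1 - h p.2))
      (unitInterval.prod halfLine) := by
  refine (Integrable.mul_prod hM hD).mono' ?_ ?_
  · refine Measurable.aestronglyMeasurable ?_
    fun_prop
  · exact ae_prod_restrict measurableSet_Ioo measurableSet_Ioi hMD

theorem integrableOn_regConv {h k : ℝ → ℂ} (hm : Measurable h) (km : Measurable k)
    (hh : IntegrableOn h (Ioi 0))
    {M D : ℝ → ℝ} (hM : IntegrableOn M (Ioo 0 1)) (hD : IntegrableOn D (Ioi 0))
    (hMD : ∀ b ∈ Ioo (0 : ℝ) 1, ∀ v ∈ Ioi (0 : ℝ), ‖k b * (h (v / b) / b - h v)‖ ≤ M b * D v) :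
    IntegrableOn (regConv h k) (Ioi 0) :=
  ((integrable_regConv_kernel hm km hM hD hMD).integral_prod_right).add hh

/-- For fixed `b` the two sides agree by the dilation `v = y b`. Each interchange of integrals needs
its own compensation of the singularity of `k` at `1`: on the left the Lipschitz bound on `g`, on
the right the bound `M b * D v` on the dilation difference of `h`. -/
theorem integral_regConv {h k g : ℝ → ℂ} (hm : Measurable h) (km : Measurable k)
    (gm : Measurable g) (hh : IntegrableOn h (Ioi 0))
    (hh1 : IntegrableOn (fun y => ‖h y‖ * y) (Ioi 0))
    (hk1 : IntegrableOn (fun b => ‖k b‖ * (1 - b)) (Ioo 0 1))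
    {M D : ℝ → ℝ} (hM : IntegrableOn M (Ioo 0 1)) (hD : IntegrableOn D (Ioi 0))
    (hMD : ∀ b ∈ Ioo (0 : ℝ) 1, ∀ v ∈ Ioi (0 : ℝ), ‖k b * (h (v / b) / b - h v)‖ ≤ M b * D v)
    {C : ℝ} (hC : ∀ u, 0 < u → ‖g u‖ ≤ C)
    (hL : ∀ u v, 0 < u → 0 < v → ‖g u - g v‖ ≤ C * |u - v|) :
    ∫ y in Ioi (0 : ℝ), h y * ((∫ b in Ioo (0 : ℝ) 1, k b * (g (y * b) - g y)) + g y) =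
      ∫ v in Ioi (0 : ℝ), regConv h k v * g v := by
  have i1 : Integrable (Function.uncurry fun y b : ℝ => h y * (k b * (g (y * b) - g y)))
      (halfLine.prod unitInterval) := by
    refine ((Integrable.mul_prod hh1 hk1).mul_const C).mono' ?_ ?_
    · refine Measurable.aestronglyMeasurable ?_
      unfold Function.uncurry
      fun_prop
    · refine ae_prod_restrict measurableSet_Ioi measurableSet_Ioo fun y hy b hb => ?_
      have hy0 : 0 < y := hy
      have h1 := hL (y * b) y (mul_pos hy hb.1) hy
      have h2 : |y * b - y| = y * (1 - b) := by
        rw [abs_of_nonpos (by nlinarith [hb.2])]; ring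
      rw [h2] at h1
      simp only [Function.uncurry, norm_mul]
      calc _ ≤ ‖h y‖ * (‖k b‖ * (C * (y * (1 - b)))) := by gcongr
        _ = _ := by ring
  have i2 : Integrable (Function.uncurry fun b v : ℝ => k b * (h (v / b) / b - h v) * g v)
      (unitInterval.prod halfLine) := by
    refine ((integrable_regConv_kernel hm km hM hD hMD).norm.mul_const C).mono' ?_ ?_
    · refine Measurable.aestronglyMeasurable ?_
      unfold Function.uncurry
      fun_prop
    · refine ae_prod_restrict measurableSet_Ioo measurableSet_Ioi fun a ha u hu => ?_
      simp only [Function.uncurry]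
      rw [norm_mul]
      gcongr
      exact hC u hu
  have bdd : ∀ f : ℝ → ℂ, IntegrableOn f (Ioi 0) → ∀ g' : ℝ → ℂ, Measurable g' →
      (∀ u, 0 < u → ‖g' u‖ ≤ C) → IntegrableOn (fun y => f y * g' y) (Ioi 0) := by
    intro f hf g' hg' hg'C
    exact Integrable.mul_bdd hf hg'.aestronglyMeasurable
      (ae_restrict_of_forall_mem measurableSet_Ioi hg'C)
  have ihg := bdd h hh g gm hC
  simp only [mul_add, regConv, add_mul, ← integral_const_mul, ← integral_mul_const]
  have j1 : IntegrableOn (fun y => ∫ b in Ioo (0 : ℝ) 1, h y * (k b * (g (y * b) - g y)))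
    (Ioi 0) := i1.integral_prod_left
  have j2 : IntegrableOn (fun v => ∫ b in Ioo (0 : ℝ) 1, k b * (h (v / b) / b - h v) * g v)
    (Ioi 0) := i2.integral_prod_right
  rw [integral_add j1 ihg, integral_add j2 ihg,
    integral_integral_swap i1, ← integral_integral_swap i2]
  congr 1
  refine setIntegral_congr_fun measurableSet_Ioo fun b hb => ?_
  simp only [mul_left_comm _ (k b), mul_assoc (k b)]
  rw [integral_const_mul, integral_const_mul]
  simp only [mul_sub, sub_mul]
  rw [integral_sub _ ihg, integral_sub _ ihg, integral_comp_mul_right_eq hb.1]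
  · exact bdd _ ((integrableOn_comp_div hh hb.1).div_const _) g gm hC
  · exact bdd h hh (fun y => g (y * b)) (by fun_prop) fun u hu => hC _ (mul_pos hu hb.1)

/-! ### Gamma and beta densities. -/

/-- The density `x ^ p e ^ (-x) / Γ(p + 1)`. -/
noncomputable def gammaDensity (p : ℂ) (x : ℝ) : ℂ :=
  (x : ℂ) ^ p / Complex.Gamma (p + 1) * Complex.exp (-(x : ℂ))

/-- The density `x ^ a (1 - x) ^ b / (Γ(a + 1) Γ(b + 1))`. -/
noncomputable def betaDensity (a b : ℂ) (x : ℝ) : ℂ :=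
  (x : ℂ) ^ a * ((1 - x : ℝ) : ℂ) ^ b / (Complex.Gamma (a + 1) * Complex.Gamma (b + 1))

theorem measurable_gammaDensity (p : ℂ) : Measurable (gammaDensity p) := by
  unfold gammaDensity
  exact ((measurable_ofReal_cpow p).div_const _).mul (by fun_prop)

theorem measurable_betaDensity (a b : ℂ) : Measurable (betaDensity a b) := by
  unfold betaDensity
  exact ((measurable_ofReal_cpow a).mul ((measurable_ofReal_cpow b).comp
    (measurable_const.sub measurable_id))).div_const _

theorem norm_gammaDensity (p : ℂ) {x : ℝ} (hx : 0 < x) :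
    ‖gammaDensity p x‖ = ‖(Complex.Gamma (p + 1))⁻¹‖ * (x ^ p.re * Real.exp (-x)) := by
  rw [gammaDensity, norm_mul, norm_div, Complex.norm_cpow_eq_rpow_re_of_pos hx, Complex.norm_exp,
    norm_inv]
  simp only [Complex.neg_re, Complex.ofReal_re]
  ring

theorem integrableOn_rpow_mul_exp_neg {a : ℝ} (ha : -1 < a) :
    IntegrableOn (fun t : ℝ => t ^ a * Real.exp (-t)) (Ioi 0) := by
  simpa using integrableOn_rpow_mul_exp (a := a + 1) (x := 1) (by linarith) one_pos

theorem integrableOn_gammaDensity {p : ℂ} (hp : -1 < p.re) :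
    IntegrableOn (gammaDensity p) (Ioi 0) :=
  Integrable.mono' ((integrableOn_rpow_mul_exp_neg hp).const_mul _)
    (measurable_gammaDensity p).aestronglyMeasurable
    (ae_restrict_of_forall_mem measurableSet_Ioi fun _ hx => (norm_gammaDensity p hx).le)

theorem integrableOn_norm_gammaDensity_mul {p : ℂ} (hp : -1 < p.re) :
    IntegrableOn (fun y => ‖gammaDensity p y‖ * y) (Ioi 0) := by
  refine IntegrableOn.congr_fun ((integrableOn_rpow_mul_exp_neg (a := p.re + 1)
    (by linarith)).const_mul ‖(Complex.Gamma (p + 1))⁻¹‖) (fun y hy => ?_) measurableSet_Ioi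
  have hy0 : (0 : ℝ) < y := hy
  rw [norm_gammaDensity p hy0, Real.rpow_add_one hy0.ne']
  ring

theorem continuousOn_ofReal_cpow (p : ℂ) : ContinuousOn (fun x : ℝ => (x : ℂ) ^ p) (Ioi 0) :=
  fun x hx => (Complex.continuousAt_ofReal_cpow_const x p
    (Or.inr (ne_of_gt hx))).continuousWithinAt

theorem continuousOn_gammaDensity (p : ℂ) : ContinuousOn (gammaDensity p) (Ioi 0) := by
  unfold gammaDensity
  exact ((continuousOn_ofReal_cpow p).div_const _).mul (by fun_prop)

theorem hasDerivAt_ofReal_cpow (p : ℂ) {x : ℝ} (hx : 0 < x) :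
    HasDerivAt (fun x : ℝ => (x : ℂ) ^ p) (p * (x : ℂ) ^ (p - 1)) x := by
  have := (hasDerivAt_id (x : ℂ)).cpow_const (c := p) (Or.inl (by simpa using hx))
  simpa using this.comp_ofReal

theorem ofReal_mul_cpow_sub_one (p : ℂ) {x : ℝ} (hx : 0 < x) :
    (x : ℂ) * (x : ℂ) ^ (p - 1) = (x : ℂ) ^ p := by
  have hx0 : (x : ℂ) ≠ 0 := by exact_mod_cast hx.ne'
  rw [Complex.cpow_sub _ _ hx0, Complex.cpow_one]
  field_simp

/-- The map `c ↦ c h(c v)` interpolates between `h(v)` at `c = 1` and `h(v / b) / b` at `c = 1 / b`;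
its derivative controls the dilation difference. -/
theorem hasDerivAt_mul_gammaDensity (p : ℂ) {c v : ℝ} (hc : 0 < c) (hv : 0 < v) :
    HasDerivAt (fun c : ℝ => (c : ℂ) * gammaDensity p (c * v))
      ((1 + p - (c * v : ℝ)) * gammaDensity p (c * v)) c := by
  have hcv : 0 < c * v := mul_pos hc hv
  have h1 : HasDerivAt (fun s : ℝ => gammaDensity p s)
      (p * ((c * v : ℝ) : ℂ) ^ (p - 1) / Complex.Gamma (p + 1) * Complex.exp (-((c * v : ℝ) : ℂ))
        - gammaDensity p (c * v)) (c * v) := by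
    have e : HasDerivAt (fun s : ℝ => Complex.exp (-(s : ℂ))) (-Complex.exp (-((c * v : ℝ) : ℂ)))
        (c * v) := by
      have := ((hasDerivAt_id ((c * v : ℝ) : ℂ)).neg).cexp
      simpa using this.comp_ofReal
    refine (((hasDerivAt_ofReal_cpow p hcv).div_const _).mul e).congr_deriv ?_
    rw [gammaDensity]
    ring
  have h2 : HasDerivAt (fun c : ℝ => c * v) v c := by
    simpa using (hasDerivAt_id c).mul_const v
  have h3 := h1.scomp c h2
  have h4 : HasDerivAt (fun c : ℝ => (c : ℂ)) 1 c := (hasDerivAt_id c).ofReal_comp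
  refine (h4.mul h3).congr_deriv ?_
  have e := ofReal_mul_cpow_sub_one p hcv
  simp only [Function.comp, Complex.real_smul, gammaDensity, ← e]
  push_cast
  ring

theorem rpow_le_one_add {a s : ℝ} (ha0 : 0 ≤ a) (ha1 : a ≤ 1) (hs : 0 < s) : s ^ a ≤ 1 + s := by
  rcases le_total s 1 with h | h
  · exact (Real.rpow_le_one hs.le h ha0).trans (by linarith)
  · exact (Real.rpow_le_rpow_of_exponent_le h ha1).trans (by simp)

theorem norm_mul_gammaDensity_le {p : ℂ} (hp0 : 0 ≤ p.re) (hp1 : p.re ≤ 1) {s : ℝ} (hs : 0 < s) :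
    ‖(1 + p - s) * gammaDensity p s‖ ≤
      8 * (1 + ‖p‖) * ‖(Complex.Gamma (p + 1))⁻¹‖ * Real.exp (-s / 2) := by
  have h1 : ‖(1 + p - s : ℂ)‖ ≤ (1 + ‖p‖) * (1 + s) := by
    have : ‖(1 + p - s : ℂ)‖ ≤ 1 + ‖p‖ + s := by
      refine (norm_sub_le _ _).trans ?_
      have := norm_add_le (1 : ℂ) p
      rw [norm_one] at this
      rw [Complex.norm_real, Real.norm_of_nonneg hs.le]
      linarith
    nlinarith [norm_nonneg p]
  have h2 : s ^ p.re ≤ 1 + s := rpow_le_one_add hp0 hp1 hs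
  -- From `e^(s/2) ≥ 1 + s/2 + s²/8`; the `8` clears the quadratic coefficient. Half of the
  -- exponential decay is spent on the polynomial factors.
  have h3 : (1 + s) * (1 + s) ≤ 8 * Real.exp (s / 2) := by
    have := Real.quadratic_le_exp_of_nonneg (x := s / 2) (by linarith)
    nlinarith
  have h4 : Real.exp (s / 2) * Real.exp (-s) = Real.exp (-s / 2) := by
    rw [← Real.exp_add]; ring_nf
  rw [norm_mul, norm_gammaDensity p hs]
  have hG := norm_nonneg (Complex.Gamma (p + 1))⁻¹
  have hP := norm_nonneg p
  calc _ ≤ ((1 + ‖p‖) * (1 + s)) * (‖(Complex.Gamma (p + 1))⁻¹‖ * ((1 + s) * Real.exp (-s))) := by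
        gcongr
    _ = (1 + ‖p‖) * ‖(Complex.Gamma (p + 1))⁻¹‖ * Real.exp (-s) * ((1 + s) * (1 + s)) := by ring
    _ ≤ (1 + ‖p‖) * ‖(Complex.Gamma (p + 1))⁻¹‖ * Real.exp (-s) * (8 * Real.exp (s / 2)) := by
        gcongr
    _ = _ := by rw [← h4]; ring

/-- The dilation difference of a Gamma density. -/
theorem norm_gammaDensity_div_sub_le {p : ℂ} (hp0 : 0 ≤ p.re) (hp1 : p.re ≤ 1) {b v : ℝ}
    (hb : b ∈ Ioo (0 : ℝ) 1) (hv : 0 < v) :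
    ‖gammaDensity p (v / b) / b - gammaDensity p v‖ ≤
      (8 * (1 + ‖p‖) * ‖(Complex.Gamma (p + 1))⁻¹‖ * Real.exp (-v / 2)) * ((1 - b) / b) := by
  have hb0 : 0 < b := hb.1
  have hb1 : 1 ≤ b⁻¹ := (one_le_inv₀ hb0).2 hb.2.le
  have := Convex.norm_image_sub_le_of_norm_hasDerivWithin_le (s := Icc 1 b⁻¹)
    (f := fun c : ℝ => (c : ℂ) * gammaDensity p (c * v))
    (f' := fun c : ℝ => (1 + p - (c * v : ℝ)) * gammaDensity p (c * v))
    (C := 8 * (1 + ‖p‖) * ‖(Complex.Gamma (p + 1))⁻¹‖ * Real.exp (-v / 2))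
    (x := 1) (y := b⁻¹)
    (fun c hc => (hasDerivAt_mul_gammaDensity p (by linarith [hc.1]) hv).hasDerivWithinAt)
    (fun c hc => (norm_mul_gammaDensity_le hp0 hp1 (mul_pos (by linarith [hc.1]) hv)).trans ?_)
    (convex_Icc _ _) (left_mem_Icc.2 hb1) (right_mem_Icc.2 hb1)
  · have e1 : ‖b⁻¹ - 1‖ = (1 - b) / b := by
      rw [Real.norm_of_nonneg (by linarith)]; field_simp
    rw [e1] at this
    have e2 : gammaDensity p (v / b) / b - gammaDensity p v =
        ((b⁻¹ : ℝ) : ℂ) * gammaDensity p (b⁻¹ * v) - ((1 : ℝ) : ℂ) * gammaDensity p (1 * v) := by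
      push_cast
      simp only [one_mul, mul_one, div_eq_mul_inv, mul_comm]
    rw [e2]
    exact this
  · have : v ≤ c * v := le_mul_of_one_le_left hv.le hc.1
    gcongr

theorem integrableOn_betaDensity {a b : ℂ} (ha : -1 < a.re) (hb : -1 < b.re) :
    IntegrableOn (betaDensity a b) (Ioo 0 1) := by
  have := integrableOn_Ioo_cpow (p := a + 1) (q := b + 1) (by simp; linarith) (by simp; linarith)
  simp only [add_sub_cancel_right] at this
  exact Integrable.div_const this _

theorem norm_betaDensity (a b : ℂ) {x : ℝ} (hx : x ∈ Ioo (0 : ℝ) 1) :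
    ‖betaDensity a b x‖ = x ^ a.re * (1 - x) ^ b.re *
      ‖(Complex.Gamma (a + 1) * Complex.Gamma (b + 1))⁻¹‖ := by
  rw [betaDensity, div_eq_mul_inv, norm_mul, norm_mul, Complex.norm_cpow_eq_rpow_re_of_pos hx.1,
    Complex.norm_cpow_eq_rpow_re_of_pos (by linarith [hx.2])]

theorem integrableOn_Ioo_rpow {a b : ℝ} (ha : -1 < a) (hb : -1 < b) :
    IntegrableOn (fun x : ℝ => x ^ a * (1 - x) ^ b) (Ioo 0 1) := by
  have := (integrableOn_Ioo_cpow (p := (a + 1 : ℝ)) (q := (b + 1 : ℝ))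
    (by simpa using by linarith) (by simpa using by linarith)).norm
  refine IntegrableOn.congr_fun this (fun x hx => ?_) measurableSet_Ioo
  rw [norm_mul, Complex.norm_cpow_eq_rpow_re_of_pos hx.1,
    Complex.norm_cpow_eq_rpow_re_of_pos (by linarith [hx.2])]
  simp

theorem integrableOn_norm_betaDensity_mul {a b : ℂ} (ha : -1 < a.re) (hb : -2 < b.re) :
    IntegrableOn (fun x => ‖betaDensity a b x‖ * (1 - x)) (Ioo 0 1) := by
  refine IntegrableOn.congr_fun ((integrableOn_Ioo_rpow (a := a.re) (b := b.re + 1) ha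
    (by linarith)).mul_const ‖(Complex.Gamma (a + 1) * Complex.Gamma (b + 1))⁻¹‖)
    (fun x hx => ?_) measurableSet_Ioo
  rw [norm_betaDensity a b hx, Real.rpow_add_one (by linarith [hx.2])]
  ring

theorem integrableOn_norm_betaDensity_mul_div {a b : ℂ} (ha : 0 < a.re) (hb : -2 < b.re) :
    IntegrableOn (fun x => ‖betaDensity a b x‖ * ((1 - x) / x)) (Ioo 0 1) := by
  refine IntegrableOn.congr_fun ((integrableOn_Ioo_rpow (a := a.re - 1) (b := b.re + 1)
    (by linarith) (by linarith)).mul_const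
    ‖(Complex.Gamma (a + 1) * Complex.Gamma (b + 1))⁻¹‖) (fun x hx => ?_) measurableSet_Ioo
  rw [norm_betaDensity a b hx, Real.rpow_add_one (by linarith [hx.2]), Real.rpow_sub_one hx.1.ne']
  ring

/-! ### The two one-variable densities and the Stieltjes transform. -/

/-- The density `φ_{-β}(x) e^{-x} ⊙ φ_{-α, α-1}`. -/
noncomputable def firstDensity (α β : ℂ) : ℝ → ℂ :=
  mulConv (gammaDensity (-β)) (betaDensity (-α) (α - 1))

/-- The density `φ_β(x) e^{-x} ⊙ φ_{α, -α-1}`. -/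
noncomputable def secondDensity (α β : ℂ) : ℝ → ℂ :=
  regConv (gammaDensity β) (betaDensity α (-α - 1))

section

variable {α β : ℂ}

theorem integrableOn_firstDensity (hα0 : 0 < α.re) (hα1 : α.re < 1) (hβ1 : β.re < 1) :
    IntegrableOn (firstDensity α β) (Ioi 0) :=
  integrableOn_mulConv (measurable_gammaDensity _) (measurable_betaDensity _ _)
    (integrableOn_gammaDensity (by simp; linarith))
    (integrableOn_betaDensity (by simp; linarith) (by simp; linarith))

/-- Under `a = 1 / (1 + t)` the factor `e^(-u/a)` becomes `e^(-u) e^(-tu)`, and all powers of `1 +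
t` cancel except the `(1 + t)^(-β)` coming from `(u / a)^(-β)`. -/
theorem firstDensity_eq {u : ℝ} (hu : 0 < u) :
    firstDensity α β u = (Complex.Gamma (1 - α) * Complex.Gamma (1 - β))⁻¹ *
      ((u : ℂ) ^ (-β) * Complex.exp (-(u : ℂ)) * tricomi α β u) := by
  rw [firstDensity, mulConv, integral_Ioo_eq_integral_Ioi, tricomi, ← integral_const_mul,
    ← integral_const_mul, ← integral_const_mul]
  refine setIntegral_congr_fun measurableSet_Ioi fun t ht => ?_
  have ht0 : (0 : ℝ) < t := ht
  have ht1 : ((1 + t : ℝ) : ℂ) ≠ 0 := by exact_mod_cast (by linarith : (1 + t) ≠ 0)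
  have e1 : Complex.exp (-((u * (1 + t) : ℝ) : ℂ)) =
      Complex.exp (-(u : ℂ)) * Complex.exp (-(t : ℂ) * u) := by
    rw [← Complex.exp_add]; push_cast; ring_nf
  have e2 : ((1 + t : ℝ) : ℂ) ^ (-2 : ℂ) * ((1 + t : ℝ) : ℂ) ^ (-(-α)) *
      ((1 + t : ℝ) : ℂ) ^ (-(α - 1)) * ((1 + t : ℝ) : ℂ) ^ (1 : ℂ) = 1 := by
    rw [← Complex.cpow_add _ _ ht1, ← Complex.cpow_add _ _ ht1, ← Complex.cpow_add _ _ ht1,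
      show (-2 : ℂ) + -(-α) + -(α - 1) + 1 = 0 by ring, Complex.cpow_zero]
  rw [Complex.cpow_one] at e2
  have e3 : (((1 + t)⁻¹ : ℝ) : ℂ) = ((1 + t : ℝ) : ℂ)⁻¹ := Complex.ofReal_inv _
  simp only [Complex.real_smul, betaDensity, gammaDensity, tricomiKernel]
  rw [inv_sq_eq_cpow, inv_one_add_cpow ht0, one_sub_inv_one_add_cpow ht0, div_inv_eq_mul, e1,
    ofReal_mul_cpow hu (by linarith), e3, div_inv_eq_mul, sub_add_cancel, neg_add_eq_sub,
    neg_add_eq_sub, mul_inv]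
  simp only [div_eq_mul_inv, mul_inv]
  linear_combination ((t : ℂ) ^ (α - 1) * (Complex.Gamma (1 - α))⁻¹ * (Complex.Gamma α)⁻¹ *
    (u : ℂ) ^ (-β) * ((1 + t : ℝ) : ℂ) ^ (-β) * (Complex.Gamma (1 - β))⁻¹ *
    Complex.exp (-(u : ℂ)) * Complex.exp (-(t : ℂ) * u)) * e2

/-- The gained factor `(1 - b) / b` makes the singularity `(1 - b)^(-α-1)` integrable at `1`, and
its pole at `0` is absorbed by `b^α`. The bound separates the variables, as `integral_regConv`
requires. -/
theorem secondDensity_kernel_le (hβ0 : 0 < β.re) (hβ1 : β.re < 1) :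
    ∀ b ∈ Ioo (0 : ℝ) 1, ∀ v ∈ Ioi (0 : ℝ),
      ‖betaDensity α (-α - 1) b * (gammaDensity β (v / b) / b - gammaDensity β v)‖ ≤
      (‖betaDensity α (-α - 1) b‖ * ((1 - b) / b)) *
        (8 * (1 + ‖β‖) * ‖(Complex.Gamma (β + 1))⁻¹‖ * Real.exp (-v / 2)) := by
  intro b hb v hv
  rw [norm_mul, mul_assoc, mul_comm ((1 - b) / b)]
  gcongr
  exact norm_gammaDensity_div_sub_le hβ0.le hβ1.le hb hv

theorem integrableOn_exp_neg_half (c : ℝ) :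
    IntegrableOn (fun v : ℝ => c * Real.exp (-v / 2)) (Ioi 0) := by
  have := integrableOn_exp_mul_Ioi (a := -(1 / 2)) (by norm_num) 0
  refine Integrable.const_mul ?_ c
  refine this.congr (Eventually.of_forall fun x => ?_)
  simp only
  ring_nf

theorem integrableOn_secondDensity (hα0 : 0 < α.re) (hα1 : α.re < 1) (hβ0 : 0 < β.re)
    (hβ1 : β.re < 1) : IntegrableOn (secondDensity α β) (Ioi 0) :=
  integrableOn_regConv (measurable_gammaDensity _) (measurable_betaDensity _ _)
    (integrableOn_gammaDensity (by linarith))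
    (integrableOn_norm_betaDensity_mul_div hα0 (by simp; linarith)) (integrableOn_exp_neg_half _)
    (secondDensity_kernel_le hβ0 hβ1)

theorem integral_secondDensity (hα0 : 0 < α.re) (hα1 : α.re < 1) (hβ0 : 0 < β.re)
    (hβ1 : β.re < 1) {g : ℝ → ℂ} (gm : Measurable g) {C : ℝ} (hC : ∀ u, 0 < u → ‖g u‖ ≤ C)
    (hL : ∀ u v, 0 < u → 0 < v → ‖g u - g v‖ ≤ C * |u - v|) :
    ∫ y in Ioi (0 : ℝ), gammaDensity β y *
        ((∫ b in Ioo (0 : ℝ) 1, betaDensity α (-α - 1) b * (g (y * b) - g y)) + g y) =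
      ∫ v in Ioi (0 : ℝ), secondDensity α β v * g v :=
  integral_regConv (measurable_gammaDensity _) (measurable_betaDensity _ _) gm
    (integrableOn_gammaDensity (by linarith)) (integrableOn_norm_gammaDensity_mul (by linarith))
    (integrableOn_norm_betaDensity_mul (by linarith) (by simp; linarith))
    (integrableOn_norm_betaDensity_mul_div hα0 (by simp; linarith)) (integrableOn_exp_neg_half _)
    (secondDensity_kernel_le hβ0 hβ1) hC hL

theorem continuousOn_secondDensity (hα0 : 0 < α.re) (hα1 : α.re < 1) (hβ0 : 0 < β.re)
    (hβ1 : β.re < 1) : ContinuousOn (secondDensity α β) (Ioi 0) := by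
  have hc := continuousOn_gammaDensity β
  refine ContinuousOn.add ?_ hc
  refine continuousOn_of_dominated (bound := fun b => (‖betaDensity α (-α - 1) b‖ * ((1 - b) / b)) *
        (8 * (1 + ‖β‖) * ‖(Complex.Gamma (β + 1))⁻¹‖)) ?_ ?_ ?_ ?_
  · intro v _
    refine Measurable.aestronglyMeasurable ?_
    have := measurable_gammaDensity β
    have := measurable_betaDensity α (-α - 1)
    fun_prop
  · intro v hv
    refine ae_restrict_of_forall_mem measurableSet_Ioo fun b hb => ?_
    refine (secondDensity_kernel_le hβ0 hβ1 b hb v hv).trans ?_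
    have hv0 : (0 : ℝ) < v := hv
    have h1 : Real.exp (-v / 2) ≤ 1 := Real.exp_le_one_iff.2 (by linarith)
    have h2 : 0 ≤ (1 - b) / b := div_nonneg (by linarith [hb.2]) hb.1.le
    refine mul_le_mul_of_nonneg_left ?_ (by positivity)
    exact mul_le_of_le_one_right (by positivity) h1
  · exact (integrableOn_norm_betaDensity_mul_div hα0 (by simp; linarith)).mul_const _
  · refine ae_restrict_of_forall_mem measurableSet_Ioo fun b hb => ?_
    refine continuousOn_const.mul (ContinuousOn.sub (ContinuousOn.div_const ?_ _) hc)
    exact hc.comp (by fun_prop) fun v hv => div_pos hv hb.1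

/-- The pairing of `φ_{α, -α-1}` with a dilated Cauchy kernel. -/
theorem integral_betaDensity_cauchy (hα0 : 0 < α.re) (hα1 : α.re < 1) {y Y : ℝ} (hy : 0 < y)
    (hY : 0 < Y) :
    (∫ b in Ioo (0 : ℝ) 1, betaDensity α (-α - 1) b *
      (1 / ((y * b + Y : ℝ) : ℂ) - 1 / ((y + Y : ℝ) : ℂ))) + 1 / ((y + Y : ℝ) : ℂ) =
      (Y : ℂ) ^ α * ((y + Y : ℝ) : ℂ) ^ (-α - 1) := by
  have hα : α ≠ 0 := by rintro rfl; simp at hα0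
  have hyY : 0 < y + Y := by linarith
  have hyYc : ((y + Y : ℝ) : ℂ) ≠ 0 := by exact_mod_cast hyY.ne'
  have hYc : (Y : ℂ) ≠ 0 := by exact_mod_cast hY.ne'
  have hc : 0 < (y + Y) / Y := by positivity
  obtain ⟨i1, e1⟩ := mellin_inv_one_add (p := 1 - α) (by simp; linarith) (by simp; linarith)
  obtain ⟨i2, e2⟩ := mellin_inv_add (p := 1 - α) (by simp; linarith) (by simp; linarith) hc
  -- Both Mellin transforms carry the constant `Γ(1 - α) Γ(α)`, which is minus the normalization of
  -- `betaDensity α (-α - 1)`.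
  have hΓ : Complex.Gamma (1 - α) * Complex.Gamma (1 - (1 - α)) =
      -(Complex.Gamma (α + 1) * Complex.Gamma (-α - 1 + 1)) := by
    rw [Complex.Gamma_add_one _ hα, sub_sub_cancel, sub_add_cancel,
      show 1 - α = -α + 1 by ring, Complex.Gamma_add_one _ (neg_ne_zero.2 hα)]
    ring
  have hΓ0 : Complex.Gamma (α + 1) * Complex.Gamma (-α - 1 + 1) ≠ 0 := by
    rw [← neg_ne_zero, ← hΓ]
    exact mul_ne_zero (Complex.Gamma_ne_zero_of_re_pos (by simp; linarith))
      (Complex.Gamma_ne_zero_of_re_pos (by simp; linarith))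
  rw [hΓ] at e1 e2
  set g := Complex.Gamma (α + 1) * Complex.Gamma (-α - 1 + 1)
  have key : ∫ b in Ioo (0 : ℝ) 1, betaDensity α (-α - 1) b *
      (1 / ((y * b + Y : ℝ) : ℂ) - 1 / ((y + Y : ℝ) : ℂ)) =
      (g * ((y + Y : ℝ) : ℂ))⁻¹ * (∫ t in Ioi (0 : ℝ), ((t : ℂ) ^ (1 - α - 1) / ((1 + t : ℝ) : ℂ)
        - (t : ℂ) ^ (1 - α - 1) / (((y + Y) / Y + t : ℝ) : ℂ))) := by
    rw [integral_Ioo_eq_integral_Ioi, ← integral_const_mul]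
    refine setIntegral_congr_fun measurableSet_Ioi fun t ht => ?_
    have ht0 : (0 : ℝ) < t := ht
    have htc : (t : ℂ) ≠ 0 := by exact_mod_cast ht0.ne'
    have ht1 : ((1 + t : ℝ) : ℂ) ≠ 0 := by exact_mod_cast (by linarith : (1 + t) ≠ 0)
    have h2 : ((1 + t : ℝ) : ℂ) ^ (-2 : ℂ) * ((1 + t : ℝ) : ℂ) ^ (-α) *
        ((1 + t : ℝ) : ℂ) ^ (-(-α - 1)) = ((1 + t : ℝ) : ℂ)⁻¹ := by
      rw [← Complex.cpow_add _ _ ht1, ← Complex.cpow_add _ _ ht1,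
        show (-2 : ℂ) + -α + -(-α - 1) = -1 by ring, Complex.cpow_neg_one]
    have h3 : (t : ℂ) ^ (1 - α - 1) = t * (t : ℂ) ^ (-α - 1) := by
      rw [ofReal_mul_cpow_sub_one _ ht0]; ring_nf
    -- Partial fractions: the difference of Cauchy kernels splits into poles at `-1` and `-(y + Y) /
    -- Y`. After integration the first cancels the separate term `1 / (y + Y)`, and the second
    -- leaves the power.
    have h4 : (1 / ((y * (1 + t)⁻¹ + Y : ℝ) : ℂ) - 1 / ((y + Y : ℝ) : ℂ)) * ((1 + t : ℝ) : ℂ)⁻¹ =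
        t * ((y + Y : ℝ) : ℂ)⁻¹ * (1 / ((1 + t : ℝ) : ℂ) - 1 / (((y + Y) / Y + t : ℝ) : ℂ)) := by
      have : 1 / (y * (1 + t)⁻¹ + Y) - 1 / (y + Y) =
          t * (y + Y)⁻¹ * (1 / (1 + t) - 1 / ((y + Y) / Y + t)) * (1 + t) := by
        have : y + Y + Y * t ≠ 0 := by positivity
        have : y + Y * (1 + t) ≠ 0 := by positivity
        field_simp
        ring
      have h5 := congrArg (fun r : ℝ => (r : ℂ)) this
      simp only [Complex.ofReal_sub, Complex.ofReal_mul, Complex.ofReal_div, Complex.ofReal_inv,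
        Complex.ofReal_one] at h5 ⊢
      rw [h5]
      field_simp
    simp only [Complex.real_smul, betaDensity]
    rw [inv_sq_eq_cpow, inv_one_add_cpow ht0, one_sub_inv_one_add_cpow ht0]
    rw [h3, mul_inv]
    change _ * (_ / g * _) = _
    rw [div_eq_mul_inv]
    linear_combination (t : ℂ) ^ (-α - 1) * g⁻¹ *
      (1 / ((y * (1 + t)⁻¹ + Y : ℝ) : ℂ) - 1 / ((y + Y : ℝ) : ℂ)) * h2 +
      (t : ℂ) ^ (-α - 1) * g⁻¹ * h4
  rw [key, integral_sub i1 i2, e1, e2]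
  have h6 : (((y + Y) / Y : ℝ) : ℂ) ^ (1 - α - 1) = ((y + Y : ℝ) : ℂ) ^ (-α) * (Y : ℂ) ^ α := by
    rw [div_eq_mul_inv, ofReal_mul_cpow hyY (inv_pos.2 hY), Complex.ofReal_inv, Complex.inv_cpow,
      ← Complex.cpow_neg]
    · ring_nf
    · rw [Complex.arg_ofReal_of_nonneg hY.le]; exact Real.pi_pos.ne
  have h7 : ((y + Y : ℝ) : ℂ) ^ (-α - 1) = ((y + Y : ℝ) : ℂ) ^ (-α) / ((y + Y : ℝ) : ℂ) := by
    rw [Complex.cpow_sub _ _ hyYc, Complex.cpow_one]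
  rw [h6, h7]
  field_simp
  ring

theorem norm_one_div_add_le {Y : ℝ} (hY : 0 < Y) {r : ℝ} (hr : 0 < r) :
    ‖1 / ((r + Y : ℝ) : ℂ)‖ ≤ 1 / Y := by
  rw [norm_div, norm_one, Complex.norm_real, Real.norm_of_nonneg (by positivity)]
  exact one_div_le_one_div_of_le hY (by linarith)

/-- The Stieltjes transform of the density `φ_β(x) e^{-x} ⊙ φ_{α, -α-1}`. -/
theorem stieltjes_secondDensity (hα0 : 0 < α.re) (hα1 : α.re < 1) (hβ0 : 0 < β.re)
    (hβ1 : β.re < 1) {Y : ℝ} (hY : 0 < Y) :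
    ∫ v in Ioi (0 : ℝ), secondDensity α β v * (1 / ((v + Y : ℝ) : ℂ)) =
      (Y : ℂ) ^ α * tricomi (α + 1) (β + 1) Y := by
  have hYc : (Y : ℂ) ≠ 0 := by exact_mod_cast hY.ne'
  rw [← integral_secondDensity hα0 hα1 hβ0 hβ1 (g := fun v => 1 / ((v + Y : ℝ) : ℂ))
    -- One constant serves as both bound and Lipschitz constant of `1 / (v + Y)`: these are `1 / Y`
    -- and `1 / Y²`.
    (C := 1 / Y + 1 / Y ^ 2) (by fun_prop)]
  · have e : ∀ y ∈ Ioi (0 : ℝ), gammaDensity β y *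
        ((∫ b in Ioo (0 : ℝ) 1, betaDensity α (-α - 1) b *
          (1 / ((y * b + Y : ℝ) : ℂ) - 1 / ((y + Y : ℝ) : ℂ))) + 1 / ((y + Y : ℝ) : ℂ)) =
        gammaDensity β y * ((Y : ℂ) ^ α * ((y + Y : ℝ) : ℂ) ^ (-α - 1)) := fun y hy => by
      rw [integral_betaDensity_cauchy hα0 hα1 hy hY]
    -- Scaling by `Y` produces `tricomi (β + 1) (α + 1)`, with the roles of the parameters
    -- exchanged; Kummer's symmetry restores their order.
    rw [setIntegral_congr_fun measurableSet_Ioi e, integral_Ioi_comp_mul _ hY,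
      tricomi_symm (by simp; linarith) (by simp; linarith) hY, tricomi, ← integral_const_mul,
      ← integral_const_mul, ← integral_const_mul, ← integral_const_mul]
    refine setIntegral_congr_fun measurableSet_Ioi fun t ht => ?_
    have ht0 : (0 : ℝ) < t := ht
    have h1 : (Y : ℂ) * (Y : ℂ) ^ β * (Y : ℂ) ^ (-α - 1) = (Y : ℂ) ^ (β + 1 - (α + 1)) := by
      nth_rewrite 1 [← Complex.cpow_one (Y : ℂ)]
      rw [← Complex.cpow_add _ _ hYc, ← Complex.cpow_add _ _ hYc]
      ring_nf
    simp only [gammaDensity, tricomiKernel]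
    rw [show Y * t + Y = Y * (1 + t) by ring, ofReal_mul_cpow hY ht0,
      ofReal_mul_cpow hY (by linarith), ← h1, add_sub_cancel_right, neg_add', Complex.ofReal_mul,
      neg_mul, mul_comm (t : ℂ)]
    ring
  · intro u hu
    refine (norm_one_div_add_le hY hu).trans ?_
    have : 0 < 1 / Y ^ 2 := by positivity
    linarith
  · intro u v hu hv
    have h1 : (1 / ((u + Y : ℝ) : ℂ) - 1 / ((v + Y : ℝ) : ℂ)) =
        ((v - u : ℝ) : ℂ) * (1 / ((u + Y : ℝ) : ℂ)) * (1 / ((v + Y : ℝ) : ℂ)) := by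
      have : ((u + Y : ℝ) : ℂ) ≠ 0 := by exact_mod_cast (by linarith : u + Y ≠ 0)
      have : ((v + Y : ℝ) : ℂ) ≠ 0 := by exact_mod_cast (by linarith : v + Y ≠ 0)
      field_simp
      push_cast
      ring
    have h2 := norm_one_div_add_le hY hu
    have h3 := norm_one_div_add_le hY hv
    rw [h1, norm_mul, norm_mul, Complex.norm_real, Real.norm_eq_abs, abs_sub_comm]
    have h4 : (0 : ℝ) < 1 / Y := by positivity
    calc _ ≤ |u - v| * (1 / Y) * (1 / Y) := by gcongr
      _ = (1 / Y ^ 2) * |u - v| := by ring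
      _ ≤ _ := by gcongr; linarith

end

/-! ### Ray integrals: convergence, continuity and decay of the factors. -/

/-- The integral of `P(x) Q(y)` along the ray through `(x, y)`, beyond that point. -/
noncomputable def rayIntegral (P Q : ℝ → ℂ) (p : ℝ × ℝ) : ℂ :=
  ∫ t in Ioi (0 : ℝ), P (p.1 * (1 + t)) * Q (p.2 * (1 + t))

/-- A function that decays like `e ^ (-u)`. -/
def ExpDecay (P : ℝ → ℂ) : Prop := ∀ δ > 0, ∃ C, ∀ u, δ ≤ u → ‖P u‖ ≤ C * Real.exp (-u)

/-- A function that is bounded away from zero. -/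
def BddAwayZero (Q : ℝ → ℂ) : Prop := ∀ δ > 0, ∃ C, ∀ u, δ ≤ u → ‖Q u‖ ≤ C

theorem isOpen_quadrant : IsOpen quadrant := isOpen_Ioi.prod isOpen_Ioi

theorem continuousOn_comp_ray {P : ℝ → ℂ} (hP : ContinuousOn P (Ioi 0)) {x : ℝ} (hx : 0 < x) :
    ContinuousOn (fun t => P (x * (1 + t))) (Ioi 0) :=
  hP.comp (by fun_prop) fun t ht => mul_pos hx (by linarith [mem_Ioi.1 ht])

theorem aestronglyMeasurable_ray {P Q : ℝ → ℂ} (hP : ContinuousOn P (Ioi 0))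
    (hQ : ContinuousOn Q (Ioi 0)) {x y : ℝ} (hx : 0 < x) (hy : 0 < y) :
    AEStronglyMeasurable (fun t => P (x * (1 + t)) * Q (y * (1 + t))) halfLine :=
  ((continuousOn_comp_ray hP hx).mul (continuousOn_comp_ray hQ hy)).aestronglyMeasurable
    measurableSet_Ioi

/-- Exponential decay of one factor and boundedness of the other away from `0` suffice. The constant
is uniform over `x ≥ a`, `y ≥ b`, so it also gives the local domination needed for continuity. -/
theorem exists_ray_bound {P Q : ℝ → ℂ} (hP : ExpDecay P) (hQ : BddAwayZero Q) {a b : ℝ}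
    (ha : 0 < a) (hb : 0 < b) : ∃ C, ∀ x y t, a ≤ x → b ≤ y → 0 < t →
      ‖P (x * (1 + t)) * Q (y * (1 + t))‖ ≤ C * Real.exp (-a * t) := by
  obtain ⟨C, hC⟩ := hP a ha
  obtain ⟨C', hC'⟩ := hQ b hb
  have hC0 : 0 ≤ C := by
    have := (norm_nonneg _).trans (hC a le_rfl)
    exact nonneg_of_mul_nonneg_left this (Real.exp_pos _)
  refine ⟨C * C', fun x y t hx hy ht => ?_⟩
  have h1 := hC (x * (1 + t)) (by nlinarith)
  have h2 := hC' (y * (1 + t)) (by nlinarith)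
  have h3 : Real.exp (-(x * (1 + t))) ≤ Real.exp (-a * t) := Real.exp_le_exp.2 (by nlinarith)
  rw [norm_mul]
  calc _ ≤ (C * Real.exp (-a * t)) * C' := by
        refine mul_le_mul (h1.trans ?_) h2 (norm_nonneg _) (by positivity)
        gcongr
    _ = _ := by ring

theorem integrableOn_const_mul_exp (C : ℝ) {a : ℝ} (ha : 0 < a) :
    IntegrableOn (fun t => C * Real.exp (-a * t)) (Ioi 0) :=
  (integrableOn_exp_mul_Ioi (a := -a) (by linarith) 0).const_mul C

theorem integrableOn_ray {P Q : ℝ → ℂ} (hPc : ContinuousOn P (Ioi 0))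
    (hQc : ContinuousOn Q (Ioi 0)) (hP : ExpDecay P) (hQ : BddAwayZero Q) {x y : ℝ}
    (hx : 0 < x) (hy : 0 < y) :
    IntegrableOn (fun t => P (x * (1 + t)) * Q (y * (1 + t))) (Ioi 0) := by
  obtain ⟨C, hC⟩ := exists_ray_bound hP hQ hx hy
  exact (integrableOn_const_mul_exp C hx).mono' (aestronglyMeasurable_ray hPc hQc hx hy)
    (ae_restrict_of_forall_mem measurableSet_Ioi fun t ht => hC x y t le_rfl le_rfl ht)

theorem continuousOn_rayIntegral {P Q : ℝ → ℂ} (hPc : ContinuousOn P (Ioi 0))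
    (hQc : ContinuousOn Q (Ioi 0)) (hP : ExpDecay P) (hQ : BddAwayZero Q) :
    ContinuousOn (rayIntegral P Q) quadrant := by
  rintro ⟨x, y⟩ ⟨hx, hy⟩
  have hx0 : (0 : ℝ) < x := hx
  have hy0 : (0 : ℝ) < y := hy
  refine ContinuousAt.continuousWithinAt ?_
  obtain ⟨C, hC⟩ := exists_ray_bound hP hQ (half_pos hx0) (half_pos hy0)
  have hn : ∀ᶠ p : ℝ × ℝ in 𝓝 (x, y), p ∈ Ioi (x / 2) ×ˢ Ioi (y / 2) :=
    (isOpen_Ioi.prod isOpen_Ioi).mem_nhds ⟨half_lt_self hx0, half_lt_self hy0⟩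
  refine continuousAt_of_dominated (bound := fun t => C * Real.exp (-(x / 2) * t)) ?_ ?_
    (integrableOn_const_mul_exp C (half_pos hx0)) ?_
  · filter_upwards [hn] with p hp
    exact aestronglyMeasurable_ray hPc hQc ((half_pos hx0).trans hp.1) ((half_pos hy0).trans hp.2)
  · filter_upwards [hn] with p hp
    exact ae_restrict_of_forall_mem measurableSet_Ioi fun t ht =>
      hC p.1 p.2 t (le_of_lt hp.1) (le_of_lt hp.2) ht
  · refine ae_restrict_of_forall_mem measurableSet_Ioi fun t ht => ?_
    have ht0 : (0 : ℝ) < t := ht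
    have h1 : ContinuousAt P (x * (1 + t)) := hPc.continuousAt (Ioi_mem_nhds (by positivity))
    have h2 : ContinuousAt Q (y * (1 + t)) := hQc.continuousAt (Ioi_mem_nhds (by positivity))
    exact (ContinuousAt.comp (f := fun p : ℝ × ℝ => p.1 * (1 + t)) h1 (by fun_prop)).mul
      (ContinuousAt.comp (f := fun p : ℝ × ℝ => p.2 * (1 + t)) h2 (by fun_prop))

/-- `u ^ (-q) e ^ (-u)` times a Tricomi function. -/
noncomputable def decayTerm (q a b : ℂ) (u : ℝ) : ℂ :=
  (u : ℂ) ^ (-q) * Complex.exp (-(u : ℂ)) * tricomi a b u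

/-- `v ^ q` times a Tricomi function. -/
noncomputable def powerTerm (q a b : ℂ) (v : ℝ) : ℂ := (v : ℂ) ^ q * tricomi a b v

section

variable {q a b : ℂ}

theorem continuousOn_tricomi (ha : 0 < a.re) (hb : 0 ≤ b.re) :
    ContinuousOn (tricomi a b) (Ioi 0) := fun _ hx =>
  (hasDerivAt_tricomi ha hb hx).continuousAt.continuousWithinAt

theorem continuousOn_decayTerm (ha : 0 < a.re) (hb : 0 ≤ b.re) :
    ContinuousOn (decayTerm q a b) (Ioi 0) :=
  ((continuousOn_ofReal_cpow _).mul (by fun_prop)).mul (continuousOn_tricomi ha hb)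

theorem continuousOn_powerTerm (ha : 0 < a.re) (hb : 0 ≤ b.re) :
    ContinuousOn (powerTerm q a b) (Ioi 0) :=
  (continuousOn_ofReal_cpow _).mul (continuousOn_tricomi ha hb)

theorem bddAwayZero_powerTerm (ha : 0 < a.re) (hb : 0 ≤ b.re) (hq : q.re ≤ a.re) :
    BddAwayZero (powerTerm q a b) := by
  intro δ hδ
  refine ⟨δ ^ (q.re - a.re) * (‖(Complex.Gamma a)⁻¹‖ * Real.Gamma a.re), fun u hu => ?_⟩
  have hu0 : 0 < u := hδ.trans_le hu
  have hG := Real.Gamma_pos_of_pos ha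
  rw [powerTerm, norm_mul, Complex.norm_cpow_eq_rpow_re_of_pos hu0]
  calc u ^ q.re * ‖tricomi a b u‖
      ≤ u ^ q.re * (‖(Complex.Gamma a)⁻¹‖ * ((1 / u) ^ a.re * Real.Gamma a.re)) := by
        gcongr
        exact norm_tricomi_le ha hb hu0
    _ = u ^ (q.re - a.re) * (‖(Complex.Gamma a)⁻¹‖ * Real.Gamma a.re) := by
        rw [Real.rpow_sub hu0, one_div, Real.inv_rpow hu0.le]
        ring
    _ ≤ _ := by
        gcongr ?_ * _
        exact Real.rpow_le_rpow_of_nonpos hδ hu (by linarith)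

theorem expDecay_decayTerm (ha : 0 < a.re) (hb : 0 ≤ b.re) (hq : 0 ≤ q.re) :
    ExpDecay (decayTerm q a b) := by
  intro δ hδ
  obtain ⟨C, hC⟩ := bddAwayZero_powerTerm (q := -q) ha hb (by simp; linarith) δ hδ
  refine ⟨C, fun u hu => ?_⟩
  have : decayTerm q a b u = powerTerm (-q) a b u * Complex.exp (-(u : ℂ)) := by
    rw [decayTerm, powerTerm]; ring
  rw [this, norm_mul, Complex.norm_exp]
  simp only [Complex.neg_re, Complex.ofReal_re]
  gcongr
  exact hC u hu

end

/-! ### The differential system and the boundary-value formula. -/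

section

variable {α β : ℂ}

/-- With `mul_deriv_tricomi_add_one` this closes a first-order system for `U = tricomi α β` and `V =
tricomi (α + 1) (β + 1)`: `x U' = -α U + α β V` and `x V' = (x + β) V - U`. -/
theorem mul_deriv_tricomi (hα : 0 < α.re) (hβ : 0 ≤ β.re) {x : ℝ} (hx : 0 < x) :
    (x : ℂ) * (-α * tricomi (α + 1) β x) =
      -α * tricomi α β x + α * β * tricomi (α + 1) (β + 1) x := by
  linear_combination -α * tricomi_integrate_by_parts hα hβ hx

theorem mul_deriv_tricomi_add_one (hα : 0 < α.re) (hβ : 0 ≤ β.re) {x : ℝ} (hx : 0 < x) :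
    (x : ℂ) * (-(α + 1) * tricomi (α + 1 + 1) (β + 1) x) =
      (x + β) * tricomi (α + 1) (β + 1) x - tricomi α β x := by
  have h := tricomi_contiguous hα hβ hx
  rw [show α + 2 = α + 1 + 1 by ring] at h
  linear_combination -(x : ℂ) * h - tricomi_integrate_by_parts hα hβ hx

theorem hasDerivAt_powerTerm {q a b T' : ℂ} {x : ℝ} (hx : 0 < x)
    (h : HasDerivAt (tricomi a b) T' x) :
    HasDerivAt (powerTerm q a b) ((x : ℂ) ^ q * (q * tricomi a b x + x * T') / x) x := by
  have hx0 : (x : ℂ) ≠ 0 := by exact_mod_cast hx.ne'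
  refine ((hasDerivAt_ofReal_cpow q hx).mul h).congr_deriv ?_
  rw [← ofReal_mul_cpow_sub_one q hx]
  field_simp

theorem hasDerivAt_decayTerm {q a b T' : ℂ} {x : ℝ} (hx : 0 < x)
    (h : HasDerivAt (tricomi a b) T' x) :
    HasDerivAt (decayTerm q a b)
      ((x : ℂ) ^ (-q) * Complex.exp (-(x : ℂ)) * ((-q - x) * tricomi a b x + x * T') / x) x := by
  have hx0 : (x : ℂ) ≠ 0 := by exact_mod_cast hx.ne'
  have e : HasDerivAt (fun s : ℝ => Complex.exp (-(s : ℂ))) (-Complex.exp (-(x : ℂ))) x := by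
    have := ((hasDerivAt_id (x : ℂ)).neg).cexp
    simpa using this.comp_ofReal
  refine (((hasDerivAt_ofReal_cpow (-q) hx).mul e).mul h).congr_deriv ?_
  simp only [Pi.mul_apply]
  rw [← ofReal_mul_cpow_sub_one (-q) hx]
  field_simp
  ring

theorem hasDerivAt_comp_ray {f : ℝ → ℂ} {f' : ℂ} {x t : ℝ} (h : HasDerivAt f f' (x * (1 + t))) :
    HasDerivAt (fun t => f (x * (1 + t))) (x * f') t := by
  have : HasDerivAt (fun t : ℝ => x * (1 + t)) x t := by
    simpa using ((hasDerivAt_id t).const_add 1).const_mul x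
  refine (h.scomp t this).congr_deriv ?_
  simp

theorem tendsto_ray {P Q : ℝ → ℂ} (hP : ExpDecay P) (hQ : BddAwayZero Q) {x y : ℝ}
    (hx : 0 < x) (hy : 0 < y) :
    Tendsto (fun t => P (x * (1 + t)) * Q (y * (1 + t))) atTop (𝓝 0) := by
  obtain ⟨C, hC⟩ := exists_ray_bound hP hQ hx hy
  have h : Tendsto (fun t => C * Real.exp (-x * t)) atTop (𝓝 (C * 0)) := by
    refine Tendsto.const_mul C (Real.tendsto_exp_atBot.comp ?_)
    exact tendsto_id.const_mul_atTop_of_neg (by linarith)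
  rw [mul_zero] at h
  refine squeeze_zero_norm' ?_ h
  filter_upwards [eventually_gt_atTop 0] with t ht
  exact hC x y t le_rfl le_rfl ht

/-- The Christoffel–Darboux type formula: the ray integral is an integrable kernel. -/
theorem sub_mul_rayIntegral (hα : 0 < α.re) (hβ : 0 < β.re) {x y : ℝ} (hx : 0 < x) (hy : 0 < y) :
    ((x - y : ℝ) : ℂ) *
        rayIntegral (decayTerm β α β) (powerTerm α (α + 1) (β + 1)) (x, y) =
      decayTerm β α β x * powerTerm α (α + 1) (β + 1) y -
        decayTerm β (α + 1) (β + 1) x * powerTerm α α β y := by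
  have hα1 : 0 < (α + 1).re := by simp; linarith
  have hβ1 : 0 < (β + 1).re := by simp; linarith
  -- Write `A`, `C` for the two decaying factors and `B`, `D` for the two power factors, in `A B - C
  -- D`. The system becomes `x A' = -(x+α+β) A + αβ C`, `x C' = -A`, `y B' = (y+α+β) B - D`, `y D' =
  -- αβ B`. All cross terms cancel in the derivative along the ray, leaving `(y - x) A B`.
  have hder : ∀ t : ℝ, 0 ≤ t → HasDerivAt
      (fun t => decayTerm β α β (x * (1 + t)) * powerTerm α (α + 1) (β + 1) (y * (1 + t)) -
        decayTerm β (α + 1) (β + 1) (x * (1 + t)) * powerTerm α α β (y * (1 + t)))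
      (((y - x : ℝ) : ℂ) * (decayTerm β α β (x * (1 + t)) *
        powerTerm α (α + 1) (β + 1) (y * (1 + t)))) t := by
    intro t ht
    have hX : 0 < x * (1 + t) := by positivity
    have hY : 0 < y * (1 + t) := by positivity
    have hxc : (x : ℂ) ≠ 0 := by exact_mod_cast hx.ne'
    have hyc : (y : ℂ) ≠ 0 := by exact_mod_cast hy.ne'
    have htc : (1 + t : ℂ) ≠ 0 := by exact_mod_cast (by linarith : 1 + t ≠ 0)
    have dA := hasDerivAt_comp_ray
      (hasDerivAt_decayTerm (q := β) hX (hasDerivAt_tricomi hα hβ.le hX))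
    have dC := hasDerivAt_comp_ray
      (hasDerivAt_decayTerm (q := β) hX (hasDerivAt_tricomi hα1 hβ1.le hX))
    have dB := hasDerivAt_comp_ray
      (hasDerivAt_powerTerm (q := α) hY (hasDerivAt_tricomi hα1 hβ1.le hY))
    have dD := hasDerivAt_comp_ray
      (hasDerivAt_powerTerm (q := α) hY (hasDerivAt_tricomi hα hβ.le hY))
    rw [mul_deriv_tricomi hα hβ.le hX] at dA
    rw [mul_deriv_tricomi hα hβ.le hY] at dD
    rw [mul_deriv_tricomi_add_one hα hβ.le hX] at dC
    rw [mul_deriv_tricomi_add_one hα hβ.le hY] at dB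
    refine ((dA.mul dB).sub (dC.mul dD)).congr_deriv ?_
    simp only [decayTerm, powerTerm]
    generalize tricomi α β (x * (1 + t)) = k1
    generalize tricomi α β (y * (1 + t)) = k2
    generalize tricomi (α + 1) (β + 1) (x * (1 + t)) = k3
    generalize tricomi (α + 1) (β + 1) (y * (1 + t)) = k4
    generalize ((x * (1 + t) : ℝ) : ℂ) ^ (-β) = c1
    generalize ((y * (1 + t) : ℝ) : ℂ) ^ α = c2
    generalize Complex.exp (-((x * (1 + t) : ℝ) : ℂ)) = c3
    push_cast
    field_simp
    ring
  have dA := expDecay_decayTerm (q := β) hα hβ.le hβ.le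
  have dC := expDecay_decayTerm (q := β) hα1 hβ1.le hβ.le
  have bB := bddAwayZero_powerTerm (q := α) hα1 hβ1.le (by simp)
  have bD := bddAwayZero_powerTerm (q := α) hα hβ.le le_rfl
  have lim := (tendsto_ray dA bB hx hy).sub (tendsto_ray dC bD hx hy)
  have int := integrableOn_ray (continuousOn_decayTerm (q := β) hα hβ.le)
    (continuousOn_powerTerm (q := α) hα1 hβ1.le) dA bB hx hy
  have := integral_Ioi_of_hasDerivAt_of_tendsto
    (hder 0 le_rfl).continuousAt.continuousWithinAt (fun t ht => hder t (le_of_lt ht))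
    (Integrable.const_mul int _) lim
  rw [integral_const_mul] at this
  simp only [add_zero, mul_one, sub_zero] at this
  rw [rayIntegral]
  simp only
  push_cast at this ⊢
  linear_combination -this

end

/-! ### The Cauchy transform of a ray integral. -/

theorem measurable_mulConv {h k : ℝ → ℂ} (hm : Measurable h) (km : Measurable k) :
    Measurable (mulConv h k) := by
  refine (StronglyMeasurable.integral_prod_right (ν := unitInterval)
    (f := fun u a : ℝ => k a * (h (u / a) / a)) ?_).measurable
  refine Measurable.stronglyMeasurable ?_
  unfold Function.uncurry
  fun_prop

theorem measurable_regConv {h k : ℝ → ℂ} (hm : Measurable h) (km : Measurable k) :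
    Measurable (regConv h k) := by
  refine Measurable.add ((StronglyMeasurable.integral_prod_right (ν := unitInterval)
    (f := fun v b : ℝ => k b * (h (v / b) / b - h v)) ?_).measurable) hm
  refine Measurable.stronglyMeasurable ?_
  unfold Function.uncurry
  fun_prop

theorem integrableOn_comp_mul {Q : ℝ → ℂ} (hQ : IntegrableOn Q (Ioi 0)) {c : ℝ} (hc : 0 < c) :
    IntegrableOn (fun s => Q (s * c)) (Ioi 0) := by
  simpa [div_eq_mul_inv] using integrableOn_comp_div hQ (inv_pos.2 hc)

theorem integral_norm_comp_mul (Q : ℝ → ℂ) {c : ℝ} (hc : 0 < c) :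
    ∫ s in Ioi (0 : ℝ), ‖Q (s * c)‖ = c⁻¹ * ∫ s in Ioi (0 : ℝ), ‖Q s‖ := by
  have := integral_comp_mul_left_Ioi (fun s => ‖Q s‖) 0 hc
  simpa [mul_comm c] using this

section

variable {P Q : ℝ → ℂ}

/-- For fixed `t` the `L¹` norm of `s ↦ Q(s(1+t))` is `‖Q‖₁ / (1 + t)`, the factor `P(x(1+t))`
decays exponentially in `t`, and the Cauchy kernel is at most `1 / y`. -/
theorem integrable_block_kernel (hPm : Measurable P) (hQm : Measurable Q) (hP : ExpDecay P)
    (hQi : IntegrableOn Q (Ioi 0)) {x y : ℝ} (hx : 0 < x) (hy : 0 < y) :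
    Integrable (fun p : ℝ × ℝ =>
      P (x * (1 + p.1)) * Q (p.2 * (1 + p.1)) * (1 / ((p.2 + y : ℝ) : ℂ)))
      (halfLine.prod halfLine) := by
  have base : Integrable (fun p : ℝ × ℝ => P (x * (1 + p.1)) * Q (p.2 * (1 + p.1)))
      (halfLine.prod halfLine) := by
    have m : Measurable fun p : ℝ × ℝ => P (x * (1 + p.1)) * Q (p.2 * (1 + p.1)) := by fun_prop
    rw [integrable_prod_iff m.aestronglyMeasurable]
    refine ⟨ae_restrict_of_forall_mem measurableSet_Ioi fun t ht => ?_, ?_⟩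
    · exact (integrableOn_comp_mul hQi (c := 1 + t) (by linarith [mem_Ioi.1 ht])).const_mul
        (P (x * (1 + t)))
    · obtain ⟨C, hC⟩ := hP x hx
      have hC0 : 0 ≤ C := by
        have := (norm_nonneg _).trans (hC x le_rfl)
        exact nonneg_of_mul_nonneg_left this (Real.exp_pos _)
      refine (integrableOn_const_mul_exp (C * ∫ s in Ioi (0 : ℝ), ‖Q s‖) hx).mono' ?_ ?_
      · exact (m.norm.stronglyMeasurable.integral_prod_right').aestronglyMeasurable
      · refine ae_restrict_of_forall_mem measurableSet_Ioi fun t ht => ?_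
        have ht0 : (0 : ℝ) < t := ht
        rw [Real.norm_of_nonneg (integral_nonneg fun _ => norm_nonneg _)]
        simp only [norm_mul]
        rw [integral_const_mul, integral_norm_comp_mul Q (c := 1 + t) (by linarith)]
        have h1 : ‖P (x * (1 + t))‖ ≤ C * Real.exp (-x * t) := by
          refine (hC _ (by nlinarith)).trans ?_
          have : -(x * (1 + t)) ≤ -x * t := by nlinarith
          gcongr
        have h2 : (1 + t)⁻¹ ≤ 1 := inv_le_one_of_one_le₀ (by linarith)
        have h3 : 0 ≤ ∫ s in Ioi (0 : ℝ), ‖Q s‖ := integral_nonneg fun _ => norm_nonneg _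
        calc _ ≤ (C * Real.exp (-x * t)) * (1 * ∫ s in Ioi (0 : ℝ), ‖Q s‖) := by gcongr
          _ = _ := by ring
  refine base.mul_bdd (c := 1 / y) (Measurable.aestronglyMeasurable (by fun_prop)) ?_
  exact ae_prod_restrict measurableSet_Ioi measurableSet_Ioi fun t _ s hs =>
    norm_one_div_add_le hy hs

theorem integrableOn_block (hPm : Measurable P) (hQm : Measurable Q) (hP : ExpDecay P)
    (hQi : IntegrableOn Q (Ioi 0)) {x y : ℝ} (hx : 0 < x) (hy : 0 < y) :
    IntegrableOn (fun s : ℝ => rayIntegral P Q (x, s) / ((s + y : ℝ) : ℂ)) (Ioi 0) := by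
  refine (integrable_block_kernel hPm hQm hP hQi hx hy).integral_prod_right.congr ?_
  refine Eventually.of_forall fun s => ?_
  simp only [rayIntegral]
  rw [integral_mul_const, mul_one_div]

/-- After interchanging integrals, `v = (1 + t) s` turns `ds / (s + y)` into `dv / (v + y(1+t))`:
the transform acts on `Q` alone and is evaluated along the same ray. -/
theorem blockPP_rayIntegral (hPm : Measurable P) (hQm : Measurable Q) (hP : ExpDecay P)
    (hQi : IntegrableOn Q (Ioi 0)) {x y : ℝ} (hx : 0 < x) (hy : 0 < y) :
    blockPP (rayIntegral P Q) x y =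
      rayIntegral P (fun Y => ∫ v in Ioi (0 : ℝ), Q v * (1 / ((v + Y : ℝ) : ℂ))) (x, y) := by
  have swap := integral_integral_swap (f := fun t s : ℝ =>
    P (x * (1 + t)) * Q (s * (1 + t)) * (1 / ((s + y : ℝ) : ℂ)))
    (integrable_block_kernel hPm hQm hP hQi hx hy)
  rw [blockPP]
  have e1 : ∀ s : ℝ, rayIntegral P Q (x, s) / ((s + y : ℝ) : ℂ) =
      ∫ t in Ioi (0 : ℝ), P (x * (1 + t)) * Q (s * (1 + t)) * (1 / ((s + y : ℝ) : ℂ)) := by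
    intro s
    rw [integral_mul_const, mul_one_div, rayIntegral]
  simp only [e1]
  rw [← swap, rayIntegral]
  refine setIntegral_congr_fun measurableSet_Ioi fun t ht => ?_
  have ht0 : (0 : ℝ) < t := ht
  have hc : 0 < 1 + t := by linarith
  have hcc : ((1 + t : ℝ) : ℂ) ≠ 0 := by exact_mod_cast hc.ne'
  simp only [mul_assoc]
  rw [integral_const_mul]
  congr 1
  rw [integral_Ioi_comp_mul (fun v => Q v * (1 / ((v + y * (1 + t) : ℝ) : ℂ))) hc,
    ← integral_const_mul]
  refine setIntegral_congr_fun measurableSet_Ioi fun s _ => ?_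
  have : ((1 + t) * s + y * (1 + t) : ℝ) = (1 + t) * (s + y) := by ring
  rw [this, Complex.ofReal_mul (1 + t) (s + y), mul_comm (1 + t) s]
  field_simp

end

/-! ### The kernel on the quadrant and its block. -/

section

variable {α β : ℂ}

theorem measurable_firstDensity : Measurable (firstDensity α β) :=
  measurable_mulConv (measurable_gammaDensity _) (measurable_betaDensity _ _)

theorem measurable_secondDensity : Measurable (secondDensity α β) :=
  measurable_regConv (measurable_gammaDensity _) (measurable_betaDensity _ _)

theorem firstDensity_eq_decayTerm {u : ℝ} (hu : 0 < u) :
    firstDensity α β u =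
      (Complex.Gamma (1 - α) * Complex.Gamma (1 - β))⁻¹ * decayTerm β α β u :=
  firstDensity_eq hu

theorem continuousOn_firstDensity (hα : 0 < α.re) (hβ : 0 < β.re) :
    ContinuousOn (firstDensity α β) (Ioi 0) :=
  (continuousOn_const.mul (continuousOn_decayTerm hα hβ.le)).congr
    fun _ hu => firstDensity_eq_decayTerm hu

theorem expDecay_firstDensity (hα : 0 < α.re) (hβ : 0 < β.re) : ExpDecay (firstDensity α β) := by
  intro δ hδ
  obtain ⟨C, hC⟩ := expDecay_decayTerm (q := β) hα hβ.le hβ.le δ hδ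
  refine ⟨‖(Complex.Gamma (1 - α) * Complex.Gamma (1 - β))⁻¹‖ * C, fun u hu => ?_⟩
  rw [firstDensity_eq_decayTerm (hδ.trans_le hu), norm_mul, mul_assoc]
  gcongr
  exact hC u hu

theorem bddAwayZero_secondDensity (hα0 : 0 < α.re) (hα1 : α.re < 1) (hβ0 : 0 < β.re)
    (hβ1 : β.re < 1) : BddAwayZero (secondDensity α β) := by
  intro δ hδ
  set M : ℝ → ℝ := fun b => (‖betaDensity α (-α - 1) b‖ * ((1 - b) / b)) *
        (8 * (1 + ‖β‖) * ‖(Complex.Gamma (β + 1))⁻¹‖)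
  have hM : IntegrableOn M (Ioo 0 1) :=
    (integrableOn_norm_betaDensity_mul_div hα0 (by simp; linarith)).mul_const _
  refine ⟨(∫ b in Ioo (0 : ℝ) 1, M b) + ‖(Complex.Gamma (β + 1))⁻¹‖ * 1, fun v hv => ?_⟩
  have hv0 : (0 : ℝ) < v := hδ.trans_le hv
  refine (norm_add_le _ _).trans (add_le_add ?_ ?_)
  · refine norm_integral_le_of_norm_le hM (ae_restrict_of_forall_mem measurableSet_Ioo
      fun b hb => ?_)
    refine (secondDensity_kernel_le hβ0 hβ1 b hb v hv0).trans ?_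
    have h1 : Real.exp (-v / 2) ≤ 1 := Real.exp_le_one_iff.2 (by linarith)
    have h2 : 0 ≤ (1 - b) / b := div_nonneg (by linarith [hb.2]) hb.1.le
    refine mul_le_mul_of_nonneg_left ?_ (by positivity)
    exact mul_le_of_le_one_right (by positivity) h1
  · rw [norm_gammaDensity β hv0]
    gcongr
    have h1 : v ^ β.re ≤ 1 + v := rpow_le_one_add hβ0.le hβ1.le hv0
    have h2 : v ^ β.re ≤ Real.exp v := h1.trans (by linarith [Real.add_one_le_exp v])
    calc _ ≤ Real.exp v * Real.exp (-v) := by gcongr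
      _ = 1 := by rw [← Real.exp_add]; simp

/-- The kernel `N(x, -y)` on the open quadrant. -/
noncomputable def kernelN (α β : ℂ) (p : ℝ × ℝ) : ℂ :=
  α * β * rayIntegral (firstDensity α β) (secondDensity α β) p

theorem continuousOn_kernelN (hα0 : 0 < α.re) (hα1 : α.re < 1) (hβ0 : 0 < β.re)
    (hβ1 : β.re < 1) : ContinuousOn (kernelN α β) quadrant :=
  continuousOn_const.mul (continuousOn_rayIntegral (continuousOn_firstDensity hα0 hβ0)
    (continuousOn_secondDensity hα0 hα1 hβ0 hβ1) (expDecay_firstDensity hα0 hβ0)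
    (bddAwayZero_secondDensity hα0 hα1 hβ0 hβ1))

theorem integrableOn_kernelN_block (hα0 : 0 < α.re) (hα1 : α.re < 1) (hβ0 : 0 < β.re)
    (hβ1 : β.re < 1) {x y : ℝ} (hx : 0 < x) (hy : 0 < y) :
    IntegrableOn (fun s : ℝ => kernelN α β (x, s) / ((s + y : ℝ) : ℂ)) (Ioi 0) := by
  have := (integrableOn_block measurable_firstDensity measurable_secondDensity
    (expDecay_firstDensity hα0 hβ0) (integrableOn_secondDensity hα0 hα1 hβ0 hβ1) hx hy).const_mul
    (α * β)
  refine this.congr (Eventually.of_forall fun s => ?_)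
  simp only [kernelN]
  ring

/-- Reconciles the prefactor `t = z z' = α β` and the normalization of the first density with the
constant in the closed form. -/
theorem Gamma_constant (hα0 : 0 < α.re) (hβ0 : 0 < β.re) :
    α * β * (Complex.Gamma (1 - α) * Complex.Gamma (1 - β))⁻¹ =
      1 / (Complex.Gamma (-α) * Complex.Gamma (-β)) := by
  have hα : α ≠ 0 := by rintro rfl; simp at hα0
  have hβ : β ≠ 0 := by rintro rfl; simp at hβ0
  rw [show 1 - α = -α + 1 by ring, show 1 - β = -β + 1 by ring,
    Complex.Gamma_add_one _ (neg_ne_zero.2 hα), Complex.Gamma_add_one _ (neg_ne_zero.2 hβ)]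
  simp only [mul_inv, one_div, inv_neg]
  field_simp

/-- The block `N_{++}` as an integral along a ray. -/
theorem blockPP_kernelN (hα0 : 0 < α.re) (hα1 : α.re < 1) (hβ0 : 0 < β.re)
    (hβ1 : β.re < 1) {x y : ℝ} (hx : 0 < x) (hy : 0 < y) :
    blockPP (kernelN α β) x y = 1 / (Complex.Gamma (-α) * Complex.Gamma (-β)) *
      rayIntegral (decayTerm β α β) (powerTerm α (α + 1) (β + 1)) (x, y) := by
  have h1 : blockPP (kernelN α β) x y =
      α * β * blockPP (rayIntegral (firstDensity α β) (secondDensity α β)) x y := by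
    simp only [blockPP, kernelN, mul_div_assoc]
    rw [integral_const_mul]
  rw [h1, blockPP_rayIntegral measurable_firstDensity measurable_secondDensity
    (expDecay_firstDensity hα0 hβ0) (integrableOn_secondDensity hα0 hα1 hβ0 hβ1) hx hy,
    ← Gamma_constant hα0 hβ0, mul_assoc (α * β)]
  congr 1
  rw [rayIntegral, rayIntegral, ← integral_const_mul]
  refine setIntegral_congr_fun measurableSet_Ioi fun t ht => ?_
  have ht0 : (0 : ℝ) < t := ht
  simp only
  rw [stieltjes_secondDensity hα0 hα1 hβ0 hβ1 (by positivity),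
    firstDensity_eq_decayTerm (by positivity), powerTerm, mul_assoc]

theorem continuousOn_block (hα0 : 0 < α.re) (hβ0 : 0 < β.re) :
    ContinuousOn (rayIntegral (decayTerm β α β) (powerTerm α (α + 1) (β + 1))) quadrant :=
  continuousOn_rayIntegral (continuousOn_decayTerm hα0 hβ0.le)
    (continuousOn_powerTerm (by simp; linarith) (by simp; linarith))
    (expDecay_decayTerm hα0 hβ0.le hβ0.le)
    (bddAwayZero_powerTerm (by simp; linarith) (by simp; linarith) (by simp))

end

/-! ### Whittaker functions and the closed expression. -/

theorem phi_eq_integral {a : ℂ} (ha : -1 < a.re) (f : ℝ → ℂ) :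
    phi a f = ∫ x in Ioi (0 : ℝ), (x : ℂ) ^ a / Complex.Gamma (a + 1) * f x := by
  have : ⌊-a.re⌋₊ = 0 := Nat.floor_eq_zero.2 (by linarith)
  simp [phi, this]

theorem whittakerW_eq {κ μ a b : ℂ} (ha : 0 < a.re) (h1 : μ - κ + 1 / 2 = a)
    (h2 : μ + κ - 1 / 2 = -b) (x : ℝ) :
    whittakerW κ μ x =
      Complex.exp (-(x : ℂ) / 2) * (x : ℂ) ^ (μ + 1 / 2) * tricomi a b x := by
  have h3 : μ - κ - 1 / 2 = a - 1 := by rw [← h1]; ring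
  rw [whittakerW, h3, h2, phi_eq_integral (by simp; linarith)]
  congr 1
  rw [tricomi, ← integral_const_mul]
  simp only [tricomiKernel, sub_add_cancel]
  refine setIntegral_congr_fun measurableSet_Ioi fun t _ => ?_
  ring

/-- The two signs of `μ` give `tricomi α β` and `tricomi β α`; Kummer's symmetry identifies them,
with `x^(α-β)` accounting for the change in the prefactor. -/
theorem whittakerW_eq_of_sign {κ μ α β : ℂ} (ha : 0 < α.re) (hb : 0 < β.re)
    (hκ : κ = (1 - α - β) / 2) (hμ : μ = (α - β) / 2 ∨ μ = -((α - β) / 2)) {x : ℝ} (hx : 0 < x) :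
    whittakerW κ μ x = Complex.exp (-(x : ℂ) / 2) * (x : ℂ) ^ ((α - β) / 2 + 1 / 2) *
      tricomi α β x := by
  have hx0 : (x : ℂ) ≠ 0 := by exact_mod_cast hx.ne'
  rcases hμ with rfl | rfl
  · rw [whittakerW_eq (a := α) (b := β) ha (by rw [hκ]; ring) (by rw [hκ]; ring)]
  · rw [whittakerW_eq (a := β) (b := α) hb (by rw [hκ]; ring) (by rw [hκ]; ring),
      tricomi_symm hb ha hx, show -((α - β) / 2) + 1 / 2 = ((α - β) / 2 + 1 / 2) - (α - β) by ring,
      Complex.cpow_sub _ _ hx0]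
    have : (x : ℂ) ^ (α - β) ≠ 0 := by simp [Complex.cpow_eq_zero_iff, hx0]
    field_simp

theorem closedPP_eq {α β μ₁ μ₂ μ₃ μ₄ : ℂ} (ha : 0 < α.re) (hb : 0 < β.re)
    (h₁ : μ₁ = (α - β) / 2 ∨ μ₁ = -((α - β) / 2)) (h₂ : μ₂ = (α - β) / 2 ∨ μ₂ = -((α - β) / 2))
    (h₃ : μ₃ = (α - β) / 2 ∨ μ₃ = -((α - β) / 2)) (h₄ : μ₄ = (α - β) / 2 ∨ μ₄ = -((α - β) / 2))
    {x y : ℝ} (hx : 0 < x) (hy : 0 < y) :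
    closedPP (-α) (-β) μ₁ μ₂ μ₃ μ₄ x y = 1 / (Complex.Gamma (-α) * Complex.Gamma (-β)) *
      ((decayTerm β α β x * powerTerm α (α + 1) (β + 1) y -
        decayTerm β (α + 1) (β + 1) x * powerTerm α α β y) / ((x - y : ℝ) : ℂ)) := by
  have hx0 : (x : ℂ) ≠ 0 := by exact_mod_cast hx.ne'
  have hy0 : (y : ℂ) ≠ 0 := by exact_mod_cast hy.ne'
  -- Shifting both parameters by one keeps `μ` and lowers `κ = (1 - α - β) / 2` by one, which
  -- matches the two first indices in the formula.
  have s : (α + 1 - (β + 1)) / 2 = (α - β) / 2 := by ring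
  have ha1 : 0 < (α + 1).re := by simp; linarith
  have hb1 : 0 < (β + 1).re := by simp; linarith
  rw [closedPP, whittakerW_eq_of_sign ha hb (by ring) h₁ hx,
    whittakerW_eq_of_sign ha1 hb1 (by ring) (by rwa [s]) hy,
    whittakerW_eq_of_sign ha1 hb1 (by ring) (by rwa [s]) hx,
    whittakerW_eq_of_sign ha hb (by ring) h₄ hy, s]
  have e1 : ((x / y : ℝ) : ℂ) ^ ((-α + -β) / 2) =
      (x : ℂ) ^ ((-α + -β) / 2) * (y : ℂ) ^ (-((-α + -β) / 2)) := by
    rw [div_eq_mul_inv, ofReal_mul_cpow hx (inv_pos.2 hy), Complex.ofReal_inv, Complex.inv_cpow,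
      ← Complex.cpow_neg]
    rw [Complex.arg_ofReal_of_nonneg hy.le]; exact Real.pi_pos.ne
  have e2 : (x : ℂ) ^ ((-α + -β) / 2) * (x : ℂ) ^ (-(1 / 2) : ℂ) *
      (x : ℂ) ^ ((α - β) / 2 + 1 / 2) = (x : ℂ) ^ (-β) := by
    rw [← Complex.cpow_add _ _ hx0, ← Complex.cpow_add _ _ hx0]; ring_nf
  have e3 : (y : ℂ) ^ (-((-α + -β) / 2)) * (y : ℂ) ^ (-(1 / 2) : ℂ) *
      (y : ℂ) ^ ((α - β) / 2 + 1 / 2) = (y : ℂ) ^ α := by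
    rw [← Complex.cpow_add _ _ hy0, ← Complex.cpow_add _ _ hy0]; ring_nf
  have e4 : Complex.exp (((y : ℂ) - x) / 2) * Complex.exp (-(x : ℂ) / 2) *
      Complex.exp (-(y : ℂ) / 2) = Complex.exp (-(x : ℂ)) := by
    rw [← Complex.exp_add, ← Complex.exp_add]; ring_nf
  rw [e1, ofReal_mul_cpow hx hy]
  simp only [decayTerm, powerTerm]
  rw [← e2, ← e3, ← e4]
  ring

/-! ### Identification of the distribution with the kernel. -/

theorem phiTwo_eq_integral {a b : ℂ} (hb : -1 < b.re) (f : ℝ → ℂ) :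
    phiTwo a b f = ∫ x in Ioo (0 : ℝ) 1, betaDensity a b x * f x := by
  have : ⌊-b.re⌋₊ = 0 := Nat.floor_eq_zero.2 (by linarith)
  simp only [phiTwo, this, Finset.range_zero, Finset.sum_empty, sub_zero, add_zero]
  rfl

theorem phiTwo_neg_sub_one {α : ℂ} (h0 : 0 < α.re) (h1 : α.re < 1) (f : ℝ → ℂ) :
    phiTwo α (-α - 1) f =
      (∫ x in Ioo (0 : ℝ) 1, betaDensity α (-α - 1) x * (f x - f 1)) + f 1 := by
  -- The real part of `-α - 1` lies in `(-2, -1)`, so exactly one Taylor term is subtracted. Its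
  -- coefficient is `1 / Γ(1) = 1`, whence the bare `f 1`.
  have : ⌊-(-α - 1).re⌋₊ = 1 := by
    rw [Nat.floor_eq_iff (by simp; linarith)]
    constructor <;> simp <;> linarith
  have e : α + (-α - 1) + 0 + 2 = 1 := by ring
  simp only [phiTwo, this, Finset.sum_range_one, iteratedDeriv_zero, Nat.factorial_zero,
    Nat.cast_one, div_one, pow_zero, mul_one, ascPochhammer_zero, Polynomial.eval_one,
    Nat.cast_zero, e, Complex.Gamma_one]
  rfl

/-- The average of a function over the segment from the origin to a point. -/
noncomputable def segmentAverage (F : ℝ × ℝ → ℂ) (u v : ℝ) : ℂ :=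
  ∫ w in Icc (0 : ℝ) 1, F (u * w, v * w)

/-- The innermost diagonal factor becomes `segmentAverage`; the other four functionals remain nested
in the order `x`, `y`, `a`, `b`. -/
theorem distN_eq (z z' : ℂ) (F : ℝ × ℝ → ℂ) :
    distN z z' F = z * z' * phi z' fun x => phi (-z') fun y =>
      (phiTwo z (-z - 1) fun a => phiTwo (-z) (z - 1) fun b =>
        segmentAverage F (x * a) (y * b)) * Complex.exp (-(x : ℂ) - (y : ℂ)) := rfl

theorem continuous_segmentAverage {F : ℝ × ℝ → ℂ} (hF : Continuous F) :
    Continuous fun p : ℝ × ℝ => segmentAverage F p.1 p.2 := by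
  unfold segmentAverage
  exact continuous_parametric_integral_of_continuous (by unfold Function.uncurry; fun_prop)
    isCompact_Icc

theorem norm_segmentAverage_le {F : ℝ × ℝ → ℂ} {C : ℝ} (hC : ∀ p, ‖F p‖ ≤ C) (u v : ℝ) :
    ‖segmentAverage F u v‖ ≤ C := by
  have := norm_setIntegral_le_of_norm_le_const (μ := volume) (s := Icc (0 : ℝ) 1)
    (f := fun w => F (u * w, v * w)) (C := C) (by simp) (fun w _ => hC _)
  simpa [segmentAverage] using this

/-- Averaging over `w ∈ [0, 1]` does not increase a Lipschitz constant; this regularity in `v` is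
what the pairing with `φ_{α,-α-1}` consumes. -/
theorem norm_segmentAverage_sub_le {F : ℝ × ℝ → ℂ} (hF : Continuous F) {K : ℝ} (hK0 : 0 ≤ K)
    (hK : ∀ p q, ‖F p - F q‖ ≤ K * ‖p - q‖) (u v v' : ℝ) :
    ‖segmentAverage F u v - segmentAverage F u v'‖ ≤ K * |v - v'| := by
  have i : ∀ v, IntegrableOn (fun w => F (u * w, v * w)) (Icc (0 : ℝ) 1) := fun v =>
    Continuous.integrableOn_Icc (by fun_prop)
  rw [segmentAverage, segmentAverage, ← integral_sub (i v) (i v')]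
  have := norm_setIntegral_le_of_norm_le_const (μ := volume) (s := Icc (0 : ℝ) 1)
    (f := fun w => F (u * w, v * w) - F (u * w, v' * w)) (C := K * |v - v'|) (by simp)
    (fun w hw => by
      refine (hK _ _).trans ?_
      gcongr
      rw [Prod.mk_sub_mk, sub_self, Prod.norm_mk, norm_zero, ← sub_mul, norm_mul,
        Real.norm_eq_abs, Real.norm_eq_abs, abs_of_nonneg hw.1]
      exact max_le (abs_nonneg _) (mul_le_of_le_one_right (abs_nonneg _) hw.2))
  simpa using this

theorem iterated_integral_comp_mul (f : ℝ → ℝ → ℂ) {c : ℝ} (hc : 0 < c) :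
    ∫ u in Ioi (0 : ℝ), ∫ v in Ioi (0 : ℝ), f u v =
      (c : ℂ) ^ 2 * ∫ u in Ioi (0 : ℝ), ∫ v in Ioi (0 : ℝ), f (c * u) (c * v) := by
  rw [integral_Ioi_comp_mul _ hc, pow_two, mul_assoc]
  congr 1
  rw [← integral_const_mul]
  refine setIntegral_congr_fun measurableSet_Ioi fun u _ => ?_
  exact integral_Ioi_comp_mul _ hc

theorem restrict_quadrant : (volume : Measure (ℝ × ℝ)).restrict quadrant =
    halfLine.prod halfLine := by
  rw [Measure.prod_restrict, ← Measure.volume_eq_prod, quadrant]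

theorem integrableOn_inv_sq : IntegrableOn (fun t : ℝ => ((1 + t) ^ 2)⁻¹) (Ioi 0) := by
  have : IntegrableOn (fun _ : ℝ => (1 : ℂ)) (Ioo 0 1) := by simp
  rw [integrableOn_Ioo_iff] at this
  have h := this.norm
  refine IntegrableOn.congr_fun h (fun t _ => ?_) measurableSet_Ioi
  simp only [norm_smul, norm_one, mul_one]
  exact Real.norm_of_nonneg (by positivity)

section

variable {P Q : ℝ → ℂ} {F : ℝ × ℝ → ℂ} {C : ℝ}

/-- For fixed `t` the two dilations give the `L¹` norm `‖P‖₁ ‖Q‖₁ / (1 + t)²`, integrable in `t`, so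
integrable `P` and `Q` suffice. -/
theorem integrable_ray_kernel (hPm : Measurable P) (hQm : Measurable Q)
    (hP : IntegrableOn P (Ioi 0)) (hQ : IntegrableOn Q (Ioi 0)) (Fm : Measurable F)
    (hC : ∀ p, ‖F p‖ ≤ C) :
    Integrable (fun q : ℝ × (ℝ × ℝ) =>
      P (q.2.1 * (1 + q.1)) * Q (q.2.2 * (1 + q.1)) * F q.2)
      (halfLine.prod (halfLine.prod halfLine)) := by
  refine Integrable.mul_bdd (c := C) ?_ (Measurable.aestronglyMeasurable (by fun_prop))
    (Eventually.of_forall fun q => hC _)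
  have m : Measurable fun q : ℝ × (ℝ × ℝ) => P (q.2.1 * (1 + q.1)) * Q (q.2.2 * (1 + q.1)) := by
    fun_prop
  rw [integrable_prod_iff m.aestronglyMeasurable]
  refine ⟨ae_restrict_of_forall_mem measurableSet_Ioi fun t ht => ?_, ?_⟩
  · have ht0 : (0 : ℝ) < t := ht
    exact Integrable.mul_prod (integrableOn_comp_mul hP (c := 1 + t) (by linarith))
      (integrableOn_comp_mul hQ (c := 1 + t) (by linarith))
  · refine IntegrableOn.congr_fun (integrableOn_inv_sq.mul_const
      ((∫ s in Ioi (0 : ℝ), ‖P s‖) * ∫ s in Ioi (0 : ℝ), ‖Q s‖)) (fun t ht => ?_) measurableSet_Ioi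
    have ht0 : (0 : ℝ) < t := ht
    simp only [norm_mul]
    rw [integral_prod_mul (fun u => ‖P (u * (1 + t))‖) (fun u => ‖Q (u * (1 + t))‖),
      integral_norm_comp_mul P (by linarith), integral_norm_comp_mul Q (by linarith)]
    field_simp

theorem integrableOn_rayIntegral_mul (hPm : Measurable P) (hQm : Measurable Q)
    (hP : IntegrableOn P (Ioi 0)) (hQ : IntegrableOn Q (Ioi 0)) (Fm : Measurable F)
    (hC : ∀ p, ‖F p‖ ≤ C) : IntegrableOn (fun p => rayIntegral P Q p * F p) quadrant := by
  rw [IntegrableOn, restrict_quadrant]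
  refine (integrable_ray_kernel hPm hQm hP hQ Fm hC).integral_prod_right.congr
    (Eventually.of_forall fun p => ?_)
  simp only [rayIntegral]
  rw [integral_mul_const]

/-- With `w = 1 / (1 + t)`, the Jacobian `(1 + t)^(-2)` of the segment variable cancels the `(1 +
t)²` from dilating both `u` and `v`. -/
theorem integral_segmentAverage (hPm : Measurable P) (hQm : Measurable Q)
    (hP : IntegrableOn P (Ioi 0)) (hQ : IntegrableOn Q (Ioi 0)) (Fm : Measurable F)
    (hC : ∀ p, ‖F p‖ ≤ C) :
    ∫ u in Ioi (0 : ℝ), P u * ∫ v in Ioi (0 : ℝ), Q v * segmentAverage F u v =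
      ∫ p in quadrant, rayIntegral P Q p * F p := by
  have i2 := integrable_ray_kernel hPm hQm hP hQ Fm hC
  have i1 : Integrable (Function.uncurry fun (p : ℝ × ℝ) (t : ℝ) => P p.1 * Q p.2 *
      ((((1 + t) ^ 2)⁻¹ : ℝ) • F (p.1 * (1 + t)⁻¹, p.2 * (1 + t)⁻¹)))
      ((halfLine.prod halfLine).prod halfLine) := by
    have b := (Integrable.mul_prod hP hQ).norm.mul_prod (integrableOn_inv_sq.mul_const C)
    refine b.mono' (Measurable.aestronglyMeasurable (by unfold Function.uncurry; fun_prop))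
      (Eventually.of_forall fun q => ?_)
    simp only [Function.uncurry, norm_mul, norm_smul]
    rw [Real.norm_of_nonneg (by positivity : (0 : ℝ) ≤ ((1 + q.2) ^ 2)⁻¹)]
    gcongr
    exact hC _
  have iPQ := Integrable.mul_prod hP hQ
  have e1 : ∀ u v : ℝ, P u * (Q v * segmentAverage F u v) = ∫ t in Ioi (0 : ℝ), P u * Q v *
      ((((1 + t) ^ 2)⁻¹ : ℝ) • F (u * (1 + t)⁻¹, v * (1 + t)⁻¹)) := by
    intro u v
    rw [segmentAverage, integral_Icc_eq_integral_Ioo, integral_Ioo_eq_integral_Ioi,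
      integral_const_mul, mul_assoc]
  simp only [← integral_const_mul (r := P _), e1]
  rw [restrict_quadrant]
  have j1 := i1.integral_prod_left
  have step1 := integral_prod _ j1
  simp only [Function.uncurry] at step1
  rw [← step1]
  have swap := integral_integral_swap i1
  rw [swap]
  have e2 : ∀ t ∈ Ioi (0 : ℝ), ∫ p, P p.1 * Q p.2 *
      ((((1 + t) ^ 2)⁻¹ : ℝ) • F (p.1 * (1 + t)⁻¹, p.2 * (1 + t)⁻¹)) ∂(halfLine.prod halfLine) =
      ∫ p, P (p.1 * (1 + t)) * Q (p.2 * (1 + t)) * F p ∂(halfLine.prod halfLine) := by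
    intro t ht
    have ht0 : (0 : ℝ) < t := ht
    have hc : 0 < 1 + t := by linarith
    have hcc : ((1 + t : ℝ) : ℂ) ≠ 0 := by exact_mod_cast hc.ne'
    rw [integral_prod, integral_prod, iterated_integral_comp_mul _ hc, ← integral_const_mul]
    · refine setIntegral_congr_fun measurableSet_Ioi fun u _ => ?_
      simp only
      rw [← integral_const_mul]
      refine setIntegral_congr_fun measurableSet_Ioi fun v _ => ?_
      simp only [Complex.real_smul]
      rw [mul_comm (1 + t) u, mul_comm (1 + t) v, mul_assoc u, mul_assoc v,
        mul_inv_cancel₀ hc.ne', mul_one, mul_one, Complex.ofReal_inv, Complex.ofReal_pow]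
      field_simp
    · refine Integrable.mul_bdd (c := C) ?_ Fm.aestronglyMeasurable
        (Eventually.of_forall fun q => hC _)
      exact Integrable.mul_prod (integrableOn_comp_mul hP hc) (integrableOn_comp_mul hQ hc)
    · refine Integrable.mul_bdd (c := ((1 + t) ^ 2)⁻¹ * C) iPQ
        (Measurable.aestronglyMeasurable (by fun_prop)) (Eventually.of_forall fun q => ?_)
      rw [norm_smul, Real.norm_of_nonneg (by positivity : (0 : ℝ) ≤ ((1 + t) ^ 2)⁻¹)]
      gcongr
      exact hC _
  rw [setIntegral_congr_fun measurableSet_Ioi e2]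
  have swap2 := integral_integral_swap (f := fun (t : ℝ) (p : ℝ × ℝ) =>
    P (p.1 * (1 + t)) * Q (p.2 * (1 + t)) * F p) i2
  rw [swap2]
  simp only [rayIntegral, ← integral_mul_const]

end

section

variable {α β : ℂ}

/-- The pairing of `(φ_{-β}(x) φ_β(y) e^{-x-y}) ⊙ (φ_{-α,α-1}(x) φ_{α,-α-1}(y))`. -/
theorem phi_phiTwo_eq (hα0 : 0 < α.re) (hα1 : α.re < 1) (hβ0 : 0 < β.re) (hβ1 : β.re < 1)
    {H : ℝ → ℝ → ℂ} (Hc : Continuous fun p : ℝ × ℝ => H p.1 p.2) {C : ℝ}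
    (hC : ∀ u v, ‖H u v‖ ≤ C) (hL : ∀ u v v', ‖H u v - H u v'‖ ≤ C * |v - v'|) :
    (phi (-β) fun x => phi β fun y =>
      (phiTwo (-α) (α - 1) fun a => phiTwo α (-α - 1) fun b => H (x * a) (y * b)) *
        Complex.exp (-(x : ℂ) - (y : ℂ))) =
      ∫ u in Ioi (0 : ℝ), firstDensity α β u * ∫ v in Ioi (0 : ℝ), secondDensity α β v * H u v := by
  have hC0 : 0 ≤ C := (norm_nonneg _).trans (hC 0 0)
  have k1m := measurable_betaDensity (-α) (α - 1)
  have k2m := measurable_betaDensity α (-α - 1)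
  have h2m := measurable_gammaDensity β
  have Hm : Measurable fun p : ℝ × ℝ => H p.1 p.2 := Hc.measurable
  have Hm' : ∀ {δ : Type} [MeasurableSpace δ] {f g : δ → ℝ}, Measurable f → Measurable g →
      Measurable fun x => H (f x) (g x) := fun hf hg => Hm.comp (hf.prodMk hg)
  -- The result of applying `φ_{α,-α-1}` in `b`. The Lipschitz bound makes it grow at most linearly
  -- in `y`, which the Gamma density absorbs.
  set M : ℝ → ℝ → ℂ := fun u y =>
    (∫ b in Ioo (0 : ℝ) 1, betaDensity α (-α - 1) b * (H u (y * b) - H u y)) + H u y with hM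
  have Mm : Measurable fun p : ℝ × ℝ => M p.1 p.2 := by
    refine Measurable.add ((StronglyMeasurable.integral_prod_right (ν := unitInterval)
      (f := fun (p : ℝ × ℝ) b => betaDensity α (-α - 1) b * (H p.1 (p.2 * b) - H p.1 p.2))
      ?_).measurable) Hm
    refine Measurable.stronglyMeasurable (Measurable.mul (by fun_prop) (Measurable.sub ?_ ?_))
    · exact Hm' (by fun_prop) (by fun_prop)
    · exact Hm' (by fun_prop) (by fun_prop)
  have hk2 := integrableOn_norm_betaDensity_mul (a := α) (b := -α - 1) (by linarith)
    (by simp; linarith)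
  set I : ℝ := ∫ b in Ioo (0 : ℝ) 1, ‖betaDensity α (-α - 1) b‖ * (1 - b)
  have hMb : ∀ u y, 0 < y → ‖M u y‖ ≤ C * I * y + C := by
    intro u y hy
    refine (norm_add_le _ _).trans (add_le_add ?_ (hC u y))
    have : C * I * y = ∫ b in Ioo (0 : ℝ) 1, (C * y) * (‖betaDensity α (-α - 1) b‖ * (1 - b)) := by
      rw [integral_const_mul]; ring
    rw [this]
    refine norm_integral_le_of_norm_le (hk2.const_mul _)
      (ae_restrict_of_forall_mem measurableSet_Ioo fun b hb => ?_)
    have h1 := hL u (y * b) y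
    have h2 : |y * b - y| = y * (1 - b) := by
      rw [abs_of_nonpos (by nlinarith [hb.2])]; ring
    rw [h2] at h1
    rw [norm_mul]
    calc _ ≤ ‖betaDensity α (-α - 1) b‖ * (C * (y * (1 - b))) := by gcongr
      _ = _ := by ring
  have inner : ∀ x y : ℝ, (phiTwo (-α) (α - 1) fun a => phiTwo α (-α - 1) fun b =>
      H (x * a) (y * b)) = ∫ a in Ioo (0 : ℝ) 1, betaDensity (-α) (α - 1) a * M (x * a) y := by
    intro x y
    rw [phiTwo_eq_integral (by simp; linarith)]
    refine integral_congr_ae (Eventually.of_forall fun a => ?_)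
    simp only
    rw [phiTwo_neg_sub_one hα0 hα1, mul_one]
  have k1i : IntegrableOn (betaDensity (-α) (α - 1)) (Ioo 0 1) :=
    integrableOn_betaDensity (by simp; linarith) (by simp; linarith)
  have h2i : IntegrableOn (gammaDensity β) (Ioi 0) := integrableOn_gammaDensity (by linarith)
  have h2i1 := integrableOn_norm_gammaDensity_mul (p := β) (by linarith)
  set G : ℝ → ℂ := fun u => ∫ v in Ioi (0 : ℝ), secondDensity α β v * H u v with hG
  have pair : ∀ u, ∫ y in Ioi (0 : ℝ), gammaDensity β y * M u y = G u := fun u =>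
    integral_secondDensity hα0 hα1 hβ0 hβ1 (g := H u) (Hm' measurable_const measurable_id)
      (C := C) (fun v _ => hC u v) (fun v v' _ _ => hL u v v')
  -- The functionals are nested as `x`, `y`, `a`, `b`, whereas the two convolutions need `y` next to
  -- `b` and `x` next to `a`: the `y` and `a` integrals are exchanged.
  have mid : ∀ x : ℝ, ∫ y in Ioi (0 : ℝ), gammaDensity β y *
      ∫ a in Ioo (0 : ℝ) 1, betaDensity (-α) (α - 1) a * M (x * a) y =
      ∫ a in Ioo (0 : ℝ) 1, betaDensity (-α) (α - 1) a * G (x * a) := by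
    intro x
    have i : Integrable (Function.uncurry fun y a : ℝ =>
        gammaDensity β y * (betaDensity (-α) (α - 1) a * M (x * a) y))
        (halfLine.prod unitInterval) := by
      have b : IntegrableOn (fun y => C * I * (‖gammaDensity β y‖ * y) + C * ‖gammaDensity β y‖)
        (Ioi 0) := (h2i1.const_mul (C * I)).add (h2i.norm.const_mul C)
      refine (Integrable.mul_prod b k1i.norm).mono' ?_ ?_
      · refine Measurable.aestronglyMeasurable ?_
        refine Measurable.mul (by fun_prop) (Measurable.mul (by fun_prop) ?_)
        exact Mm.comp ((measurable_snd.const_mul x).prodMk measurable_fst)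
      · refine ae_prod_restrict measurableSet_Ioi measurableSet_Ioo fun y hy a _ => ?_
        have := hMb (x * a) y hy
        simp only [Function.uncurry, norm_mul]
        calc _ ≤ ‖gammaDensity β y‖ * (‖betaDensity (-α) (α - 1) a‖ * (C * I * y + C)) := by gcongr
          _ = _ := by ring
    simp only [← integral_const_mul]
    rw [integral_integral_swap i]
    simp only [mul_left_comm (gammaDensity β _), integral_const_mul, pair]
  have Ψi := integrableOn_secondDensity (α := α) (β := β) hα0 hα1 hβ0 hβ1
  have Gm : Measurable G := by
    refine (StronglyMeasurable.integral_prod_right (ν := halfLine)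
      (f := fun u v => secondDensity α β v * H u v) ?_).measurable
    have := measurable_secondDensity (α := α) (β := β)
    exact Measurable.stronglyMeasurable (Measurable.mul (by fun_prop) Hm)
  have Gb : ∀ u, 0 < u → ‖G u‖ ≤ ∫ v in Ioi (0 : ℝ), ‖secondDensity α β v‖ * C := by
    intro u _
    refine norm_integral_le_of_norm_le (Ψi.norm.mul_const C) (Eventually.of_forall fun v => ?_)
    rw [norm_mul]
    gcongr
    exact hC u v
  have last := integral_mulConv (measurable_gammaDensity (-β)) k1m Gm
    (integrableOn_gammaDensity (p := -β) (by simp; linarith)) k1i Gb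
  rw [show firstDensity α β = mulConv (gammaDensity (-β)) (betaDensity (-α) (α - 1)) from rfl,
    ← last, phi_eq_integral (by simp; linarith)]
  refine integral_congr_ae (Eventually.of_forall fun x => ?_)
  simp only
  rw [← mid x, phi_eq_integral (by linarith), gammaDensity, mul_assoc]
  congr 1
  rw [← integral_const_mul]
  refine integral_congr_ae (Eventually.of_forall fun y => ?_)
  simp only [inner, gammaDensity]
  rw [sub_eq_add_neg (-(x : ℂ)), Complex.exp_add]
  ring

theorem isRepresentedBy_kernelN (hα0 : 0 < α.re) (hα1 : α.re < 1) (hβ0 : 0 < β.re)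
    (hβ1 : β.re < 1) : IsRepresentedBy (distN (-α) (-β)) (kernelN α β) := by
  have Φi := integrableOn_firstDensity (β := β) hα0 hα1 hβ1
  have Ψi := integrableOn_secondDensity hα0 hα1 hβ0 hβ1
  refine ⟨continuousOn_kernelN hα0 hα1 hβ0 hβ1, fun F hF hFc => ?_, fun F hF hFc => ?_⟩
  · obtain ⟨C, hC⟩ := hFc.exists_bound_of_continuous hF.continuous
    have := (integrableOn_rayIntegral_mul measurable_firstDensity measurable_secondDensity Φi Ψi
      hF.continuous.measurable hC).const_mul (α * β)
    refine this.congr (Eventually.of_forall fun p => ?_)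
    simp only [kernelN]
    ring
  · obtain ⟨C, hC⟩ := hFc.exists_bound_of_continuous hF.continuous
    -- A smooth compactly supported function is bounded and Lipschitz, all that the pairing
    -- requires; `max C K` below serves both purposes.
    obtain ⟨K, hK⟩ := ContDiff.lipschitzWith_of_hasCompactSupport hFc hF (by simp)
    have hL := norm_segmentAverage_sub_le hF.continuous K.coe_nonneg
      (fun p q => hK.norm_sub_le p q)
    rw [distN_eq, neg_neg, neg_neg, phi_phiTwo_eq hα0 hα1 hβ0 hβ1
      (continuous_segmentAverage hF.continuous) (C := max C K)
      (fun u v => (norm_segmentAverage_le hC u v).trans (le_max_left _ _))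
      (fun u v v' => (hL u v v').trans (by gcongr; exact le_max_right _ _)),
      integral_segmentAverage measurable_firstDensity measurable_secondDensity Φi Ψi
      hF.continuous.measurable hC, neg_mul_neg, ← integral_const_mul]
    simp only [kernelN, mul_assoc]

end

/-- A distribution is represented by at most one function on the open quadrant. -/
theorem IsRepresentedBy.eqOn {T : (ℝ × ℝ → ℂ) → ℂ} {n n' : ℝ × ℝ → ℂ}
    (h : IsRepresentedBy T n) (h' : IsRepresentedBy T n') : EqOn n n' quadrant := by
  have hd : ContinuousOn (fun p => n p - n' p) quadrant := h.continuousOn.sub h'.continuousOn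
  have hae := isOpen_quadrant.ae_eq_zero_of_integral_contDiff_smul_eq_zero (μ := volume)
    (hd.locallyIntegrableOn isOpen_quadrant.measurableSet) ?_
  · refine Measure.eqOn_open_of_ae_eq (μ := volume) ?_ isOpen_quadrant h.continuousOn
      h'.continuousOn
    rw [EventuallyEq, ae_restrict_iff' isOpen_quadrant.measurableSet]
    filter_upwards [hae] with p hp hpq
    exact sub_eq_zero.1 (hp hpq)
  · intro g hg hgc hgs
    have cF : ContDiff ℝ (⊤ : ℕ∞) fun p => (g p : ℂ) := Complex.ofRealCLM.contDiff.comp hg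
    have cc : HasCompactSupport fun p => (g p : ℂ) := hgc.comp_left Complex.ofReal_zero
    have e := (h.eq_integral _ cF cc).symm.trans (h'.eq_integral _ cF cc)
    have e0 := sub_eq_zero.2 e
    rw [← integral_sub (h.integrableOn _ cF cc) (h'.integrableOn _ cF cc)] at e0
    rw [← e0, ← setIntegral_eq_integral_of_forall_compl_eq_zero (s := quadrant)]
    · refine setIntegral_congr_fun isOpen_quadrant.measurableSet fun p _ => ?_
      simp only [Complex.real_smul]
      ring
    · intro p hp
      rw [image_eq_zero_of_notMem_tsupport fun hp' => hp (hgs hp'), zero_smul]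

end WhittakerKernel

/-! ### Conclusion. -/

theorem proposition2p2 (z z' : ℂ)
    (hz : -1 < z.re ∧ z.re < 0) (hz' : -1 < z'.re ∧ z'.re < 0) :
    (∃ n : ℝ × ℝ → ℂ, WhittakerKernel.IsRepresentedBy (WhittakerKernel.distN z z') n) ∧
    ∀ n : ℝ × ℝ → ℂ, WhittakerKernel.IsRepresentedBy (WhittakerKernel.distN z z') n →
      (∀ x y : ℝ, 0 < x → 0 < y →
        IntegrableOn (fun s : ℝ => n (x, s) / ((s + y : ℝ) : ℂ)) (Ioi 0)) ∧
      ∀ μ₁ ∈ ({(z - z') / 2, -((z - z') / 2)} : Set ℂ),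
      ∀ μ₂ ∈ ({(z - z') / 2, -((z - z') / 2)} : Set ℂ),
      ∀ μ₃ ∈ ({(z - z') / 2, -((z - z') / 2)} : Set ℂ),
      ∀ μ₄ ∈ ({(z - z') / 2, -((z - z') / 2)} : Set ℂ),
        (∀ x y : ℝ, 0 < x → 0 < y → x ≠ y →
          WhittakerKernel.blockPP n x y =
            WhittakerKernel.closedPP z z' μ₁ μ₂ μ₃ μ₄ x y) ∧
        (∀ x : ℝ, 0 < x →
          Tendsto (fun p : ℝ × ℝ => WhittakerKernel.closedPP z z' μ₁ μ₂ μ₃ μ₄ p.1 p.2)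
            (𝓝[{p : ℝ × ℝ | p.1 ≠ p.2}] (x, x)) (𝓝 (WhittakerKernel.blockPP n x x))) := by
  open WhittakerKernel in
  obtain ⟨α, rfl⟩ : ∃ α, z = -α := ⟨-z, (neg_neg z).symm⟩
  obtain ⟨β, rfl⟩ : ∃ β, z' = -β := ⟨-z', (neg_neg z').symm⟩
  simp only [Complex.neg_re] at hz hz'
  have hα0 : 0 < α.re := by linarith
  have hα1 : α.re < 1 := by linarith
  have hβ0 : 0 < β.re := by linarith
  have hβ1 : β.re < 1 := by linarith
  have rep := isRepresentedBy_kernelN hα0 hα1 hβ0 hβ1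
  refine ⟨⟨_, rep⟩, fun n hn => ?_⟩
  have hnk := hn.eqOn rep
  have hblock : ∀ {x y : ℝ}, 0 < x → blockPP n x y = blockPP (kernelN α β) x y := fun hx =>
    setIntegral_congr_fun measurableSet_Ioi fun s hs =>
      congrArg (· / _) (hnk (mk_mem_prod hx hs))
  refine ⟨fun x y hx hy => ?_, fun μ₁ h₁ μ₂ h₂ μ₃ h₃ μ₄ h₄ => ?_⟩
  · refine (integrableOn_kernelN_block hα0 hα1 hβ0 hβ1 hx hy).congr_fun (fun s hs => ?_)
      measurableSet_Ioi
    exact congrArg (· / _) (hnk (mk_mem_prod hx hs)).symm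
  have conv : ∀ μ : ℂ, μ ∈ ({(-α - -β) / 2, -((-α - -β) / 2)} : Set ℂ) →
      μ = (α - β) / 2 ∨ μ = -((α - β) / 2) := by
    rintro μ (rfl | rfl)
    · right; ring
    · left; ring
  have closed : ∀ {x y : ℝ}, 0 < x → 0 < y → x ≠ y →
      closedPP (-α) (-β) μ₁ μ₂ μ₃ μ₄ x y = blockPP (kernelN α β) x y := by
    intro x y hx hy hxy
    have hxy' : ((x - y : ℝ) : ℂ) ≠ 0 := by exact_mod_cast sub_ne_zero.2 hxy
    rw [closedPP_eq hα0 hβ0 (conv _ h₁) (conv _ h₂) (conv _ h₃) (conv _ h₄) hx hy,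
      blockPP_kernelN hα0 hα1 hβ0 hβ1 hx hy, ← sub_mul_rayIntegral hα0 hβ0 hx hy,
      mul_div_cancel_left₀ _ hxy']
  refine ⟨fun x y hx hy hxy => (hblock hx).trans (closed hx hy hxy).symm, fun x hx => ?_⟩
  rw [hblock hx, blockPP_kernelN hα0 hα1 hβ0 hβ1 hx hx]
  have hq : quadrant ∈ 𝓝 ((x, x) : ℝ × ℝ) := isOpen_quadrant.mem_nhds ⟨hx, hx⟩
  -- The ray integral is defined and continuous across the diagonal and equals the closed expression
  -- off it, up to the Gamma constant; this gives the limit.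
  have hc := ((continuousOn_block hα0 hβ0).continuousAt hq).const_mul
    (1 / (Complex.Gamma (-α) * Complex.Gamma (-β)))
  refine (hc.tendsto.mono_left nhdsWithin_le_nhds).congr' ?_
  filter_upwards [mem_nhdsWithin_of_mem_nhds hq, self_mem_nhdsWithin] with p hp hne
  rw [closed hp.1 hp.2 hne, blockPP_kernelN hα0 hα1 hβ0 hβ1 hp.1 hp.2]
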